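/- Let $(\overline M^{\,n+1},\overline g)$ be a semi-Riemannian manifold with Levi-Civita connection $\overline\nabla$, and let $x:M^n\to\overline M$ be an embedded null hypersurface: $g=x^*\overline g$ is degenerate at every point. Let $N$ be a null rigging for $M$, that is, a smooth vector field on an open set containing $M$ which, along $M$, is lightlike and nowhere tangent to $M$. Put $\eta=x^*\big(\overline g(N,\cdot)\big)$ and assume $d\eta=0$ on $M$. The screen distribution is $\mathcal S(TM)=\ker\eta$, and the rigged field $\xi$ is the unique section of $TM^\perp$ with $\overline g(\xi,N)=1$. The induced connection $\nabla$, the second fundamental forms $B$ and $C$, and the rotation form $\tau$ are given, for vector fields $U,V$ on $M$ and $W$ a section of $\mathcal S(TM)$, by $$\overline\nabla_UV=\nabla_UV+B(U,V)N,\qquad C(U,W)=\overline g(\nabla_UW,N),\qquad \tau(U)=\overline g(\overline\nabla_UN,\xi).$$ Let $\alpha$ be a smooth nowhere vanishing function on $M$ that is constant on each leaf of the (integrable) screen distribution, and let $R_\alpha$ be the curvature tensor of the Levi-Civita connection of the semi-Riemannian metric $g_\alpha=g+\alpha\,\eta\otimes\eta$ on $M$. Curvature tensors follow the convention $R(U,V)W=\nabla_U\nabla_VW-\nabla_V\nabla_UW-\nabla_{[U,V]}W$.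 Sectional curvatures of nondegenerate planes follow the convention $$K_\alpha(\mathrm{span}(U,V))=\frac{g_\alpha(R_\alpha(U,V)U,V)}{g_\alpha(U,U)g_\alpha(V,V)-g_\alpha(U,V)^2},\qquad \overline K(\mathrm{span}(U,V))=\frac{\overline g(\overline R(U,V)U,V)}{\overline g(U,U)\overline g(V,V)-\overline g(U,V)^2}.$$ With the same sign convention, the null sectional curvature with respect to $\xi$ of $\Pi_0=\mathrm{span}(\xi,\mathcal X)$ is $\overline K_\xi(\Pi_0)=\overline g(\overline R(\xi,\mathcal X)\xi,\mathcal X)/\overline g(\mathcal X,\mathcal X)$. Let $\mathcal X,\mathcal Y$ be orthogonal smooth (local) sections of $\mathcal S(TM)$, $\Pi_0=\mathrm{span}(\xi,\mathcal X)$ and $\Pi=\mathrm{span}(\mathcal X,\mathcal Y)$. Then: 1. At every point where $g(\mathcal X,\mathcal X)\neq0$, $$K_\alpha(\Pi_0)=\frac1{\alpha\, g(\mathcal X,\mathcal X)}\Big[\overline g(\overline R(\xi,\mathcal X)\xi,\mathcal X)+\Big(\tau(\xi)+\frac1{2\alpha}d\alpha(\xi)\Big)B(\mathcal X,\mathcal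 X)\Big];$$ equivalently, $$K_\alpha(\Pi_0)=\frac1{\alpha\, g(\mathcal X,\mathcal X)}\Big[g(\mathcal X,\mathcal X)\,\overline K_\xi(\Pi_0)+\Big(\tau(\xi)+\frac1{2\alpha}d\alpha(\xi)\Big)B(\mathcal X,\mathcal X)\Big].$$ 2. At every point where $g(\mathcal X,\mathcal X)\neq0$ and $g(\mathcal Y,\mathcal Y)\neq0$, $$K_\alpha(\Pi)=\overline K(\Pi)+\frac{B(\mathcal X,\mathcal X)B(\mathcal Y,\mathcal Y)-B(\mathcal X,\mathcal Y)^2}{\alpha\, g(\mathcal X,\mathcal X)g(\mathcal Y,\mathcal Y)}+\frac{2B(\mathcal X,\mathcal Y)C(\mathcal X,\mathcal Y)-B(\mathcal X,\mathcal X)C(\mathcal Y,\mathcal Y)-B(\mathcal Y,\mathcal Y)C(\mathcal X,\mathcal X)}{g(\mathcal X,\mathcal X)g(\mathcal Y,\mathcal Y)}.$$ -/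

import Mathlib

open Bundle Set
open scoped Manifold ContDiff Topology

noncomputable section

namespace NullHyp

/-! ## Coordinate formulas for the Levi-Civita connection and its curvature

`G : E → E →L[ℝ] E →L[ℝ] ℝ` is the matrix of a semi-Riemannian metric in a chart with values
in the vector space `E`. -/

section Coordinates

variable {E : Type*} [NormedAddCommGroup E] [NormedSpace ℝ E]

/-- For constant vectors `u`, `v`, the covector
`w ↦ (D_u G)(v, w) + (D_v G)(u, w) - (D_w G)(u, v)`, the right-hand side of Koszul's formula for
`2 G(∇_u v, w)`. -/
def koszul (G : E → E →L[ℝ] E →L[ℝ] ℝ) (y u v : E) : E →L[ℝ] ℝ :=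
  fderiv ℝ G y u v + fderiv ℝ G y v u - ((fderiv ℝ G y).flip u).flip v

/-- The Christoffel map `Γ_y(u, v) = ∇_u v` of the Levi-Civita connection of `G`:
`2 G_y(Γ_y(u, v), ·)` is the Koszul covector. In indices,
`Γ^k_{ij} = (1/2) G^{kl} (∂_i G_{jl} + ∂_j G_{il} - ∂_l G_{ij})`. -/
def christoffel (G : E → E →L[ℝ] E →L[ℝ] ℝ) (y u v : E) : E :=
  (1 / 2 : ℝ) • (G y).inverse (koszul G y u v)

/-- The curvature `R(u, v) w = ∇_u ∇_v w - ∇_v ∇_u w` for constant vectors `u`, `v`, `w`. -/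
def coordCurvature (G : E → E →L[ℝ] E →L[ℝ] ℝ) (y u v w : E) : E :=
  fderiv ℝ (fun z => christoffel G z v w) y u - fderiv ℝ (fun z => christoffel G z u w) y v
    + christoffel G y u (christoffel G y v w) - christoffel G y v (christoffel G y u w)

end Coordinates

/-! ## Metrics, connections and curvature on manifolds

In Mathlib the tangent space at `p` is the model space `E`, identified through the preferred
chart at `p`; this chart is therefore the one in which tensors at `p` are computed. -/

section Manifolds

variable {E : Type*} [NormedAddCommGroup E] [NormedSpace ℝ E]
  {M : Type*} [TopologicalSpace M] [ChartedSpace E M]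

/-- Fields of bilinear forms on the tangent spaces of `M`. -/
abbrev BilinField (E : Type*) [NormedAddCommGroup E] [NormedSpace ℝ E]
    (M : Type*) [TopologicalSpace M] [ChartedSpace E M] :=
  ∀ p : M, TangentSpace 𝓘(ℝ, E) p →L[ℝ] TangentSpace 𝓘(ℝ, E) p →L[ℝ] ℝ

/-- Fields of linear forms on the tangent spaces of `M`. -/
abbrev OneForm (E : Type*) [NormedAddCommGroup E] [NormedSpace ℝ E]
    (M : Type*) [TopologicalSpace M] [ChartedSpace E M] :=
  ∀ p : M, TangentSpace 𝓘(ℝ, E) p →L[ℝ] ℝ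

variable [IsManifold 𝓘(ℝ, E) ∞ M]

/-- The coordinate frame of the chart at `c`: the isomorphism `E → T_q M` that is the derivative of
the inverse of the chart at `c`. -/
def frame (c q : M) : E →L[ℝ] TangentSpace 𝓘(ℝ, E) q :=
  (trivializationAt E (TangentSpace 𝓘(ℝ, E) : M → Type _) c).symmL ℝ q

/-- Components of a tangent vector at `q` in the chart at `c`: the derivative at `q` of the chart
at `c`. -/
def coframe (c q : M) : TangentSpace 𝓘(ℝ, E) q →L[ℝ] E :=
  (trivializationAt E (TangentSpace 𝓘(ℝ, E) : M → Type _) c).continuousLinearMapAt ℝ q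

/-- The expression of a field of bilinear forms in the chart at `c`. -/
def inChart (h : BilinField E M) (c : M) (y : E) : E →L[ℝ] E →L[ℝ] ℝ :=
  (ContinuousLinearMap.precomp ℝ (frame c ((extChartAt 𝓘(ℝ, E) c).symm y))).comp
    ((h ((extChartAt 𝓘(ℝ, E) c).symm y)).comp (frame c ((extChartAt 𝓘(ℝ, E) c).symm y)))

/-- The expression of a `1`-form in the chart at `c`. -/
def formInChart (θ : OneForm E M) (c : M) (y : E) : E →L[ℝ] ℝ :=
  (θ ((extChartAt 𝓘(ℝ, E) c).symm y)).comp (frame c ((extChartAt 𝓘(ℝ, E) c).symm y))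

/-- The exterior derivative `dθ(u, v)` of a `1`-form at `p`, in coordinates
`(∂_i θ_j - ∂_j θ_i) u^i v^j`. -/
def dForm (θ : OneForm E M) (p : M) (u v : TangentSpace 𝓘(ℝ, E) p) : ℝ :=
  fderiv ℝ (formInChart θ p) (extChartAt 𝓘(ℝ, E) p p) u v
    - fderiv ℝ (formInChart θ p) (extChartAt 𝓘(ℝ, E) p p) v u

/-- A `1`-form is closed if its exterior derivative vanishes. -/
def IsClosedForm (θ : OneForm E M) : Prop :=
  ∀ (p : M) (u v : TangentSpace 𝓘(ℝ, E) p), dForm θ p u v = 0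

/-- The Riemann curvature `R(u, v) w`, with the sign convention
`R(U, V) W = ∇_U ∇_V W - ∇_V ∇_U W - ∇_[U, V] W`, of the Levi-Civita connection of `h`. -/
def curvature (h : BilinField E M) (p : M) (u v w : TangentSpace 𝓘(ℝ, E) p) :
    TangentSpace 𝓘(ℝ, E) p :=
  coordCurvature (E := E) (inChart h p) (extChartAt 𝓘(ℝ, E) p p) u v w

/-- The sectional curvature of the plane spanned by `u` and `v`, with the sign convention
`h(R(u, v) u, v) / (h(u, u) h(v, v) - h(u, v)²)`. -/
def sectionalCurvature (h : BilinField E M) (p : M) (u v : TangentSpace 𝓘(ℝ, E) p) : ℝ :=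
  h p (curvature h p u v u) v / (h p u u * h p v v - h p u v ^ 2)

/-- The null sectional curvature, with respect to the null vector `ξ`, of the plane spanned by `ξ`
and `u`; the sign convention is that of `sectionalCurvature`. -/
def nullSectionalCurvature (h : BilinField E M) (p : M) (ξ u : TangentSpace 𝓘(ℝ, E) p) : ℝ :=
  h p (curvature h p ξ u ξ) u / h p u u

/-- The leaf through `p` of the distribution `ker θ` of a closed, nowhere vanishing `1`-form: the
set of the points joined to `p` by a `C¹` curve tangent to `ker θ`. -/
def leaf (θ : OneForm E M) (p : M) : Set M :=
  {q | ∃ γ : ℝ → M, ContMDiff 𝓘(ℝ, ℝ) 𝓘(ℝ, E) 1 γ ∧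
    (∀ t : ℝ, θ (γ t) (mfderiv 𝓘(ℝ, ℝ) 𝓘(ℝ, E) γ t (1 : ℝ)) = 0) ∧ γ 0 = p ∧ γ 1 = q}

/-- The function `α` is constant on each leaf of `ker θ`. -/
def ConstantOnLeaves (θ : OneForm E M) (α : M → ℝ) : Prop :=
  ∀ p : M, ∀ q ∈ leaf θ p, α q = α p

/-- `X` is a smooth vector field on the open set `U`. -/
def SmoothFieldOn (X : ∀ p : M, TangentSpace 𝓘(ℝ, E) p) (U : Set M) : Prop :=
  ContMDiffOn 𝓘(ℝ, E) (𝓘(ℝ, E).prod 𝓘(ℝ, E)) ∞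
    (fun p => (⟨p, X p⟩ : TotalSpace E (TangentSpace 𝓘(ℝ, E) : M → Type _))) U

variable (E M) in
/-- Smooth semi-Riemannian metrics: smooth fields of symmetric nondegenerate bilinear forms. -/
structure SemiRiemannianMetric where
  val : BilinField E M
  symm : ∀ (p : M) (u v : TangentSpace 𝓘(ℝ, E) p), val p u v = val p v u
  nondegenerate : ∀ (p : M) (u : TangentSpace 𝓘(ℝ, E) p), (∀ v, val p u v = 0) → u = 0
  contMDiff : ContMDiff 𝓘(ℝ, E) (𝓘(ℝ, E).prod 𝓘(ℝ, E →L[ℝ] E →L[ℝ] ℝ)) ∞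
    (fun p => TotalSpace.mk' (E →L[ℝ] E →L[ℝ] ℝ)
      (E := fun p : M => TangentSpace 𝓘(ℝ, E) p →L[ℝ] TangentSpace 𝓘(ℝ, E) p →L[ℝ] ℝ) p (val p))

end Manifolds

/-! ## Null hypersurfaces and null riggings -/

section Hypersurfaces

variable {E : Type*} [NormedAddCommGroup E] [NormedSpace ℝ E]
  {M : Type*} [TopologicalSpace M] [ChartedSpace E M] [IsManifold 𝓘(ℝ, E) ∞ M]
  {F : Type*} [NormedAddCommGroup F] [NormedSpace ℝ F]
  {M' : Type*} [TopologicalSpace M'] [ChartedSpace F M'] [IsManifold 𝓘(ℝ, F) ∞ M']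

/-- The differential of `x : M → M'`. -/
abbrev diff (x : M → M') (p : M) : TangentSpace 𝓘(ℝ, E) p →L[ℝ] TangentSpace 𝓘(ℝ, F) (x p) :=
  mfderiv 𝓘(ℝ, E) 𝓘(ℝ, F) x p

/-- The covariant derivative `∇'_u V`, for the Levi-Civita connection `∇'` of the metric `h` of
`M'`, of a vector field `V` along `x : M → M'` in the direction of `u ∈ T_p M`; in coordinates
`∂_u V^k + Γ^k_{ij}(x) (dx u)^i V^j`. -/
def covDerivAlong (h : BilinField F M') (x : M → M') (V : ∀ q : M, TangentSpace 𝓘(ℝ, F) (x q))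
    (p : M) (u : TangentSpace 𝓘(ℝ, E) p) : TangentSpace 𝓘(ℝ, F) (x p) :=
  fderiv ℝ (fun y : E => coframe (x p) (x ((extChartAt 𝓘(ℝ, E) p).symm y))
      (V ((extChartAt 𝓘(ℝ, E) p).symm y))) (extChartAt 𝓘(ℝ, E) p p) u
    + christoffel (E := F) (inChart h (x p)) (extChartAt 𝓘(ℝ, F) (x p) (x p)) (diff (E := E) (F := F) x p u) (V p)

/-- The form `g = x^* h` induced on `M`. -/
def inducedForm (h : BilinField F M') (x : M → M') : BilinField E M := fun p =>
  (ContinuousLinearMap.precomp ℝ (diff (E := E) (F := F) x p)).comp ((h (x p)).comp (diff (E := E) (F := F) x p))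

/-- `x : M → M'` is an embedding of `M` as a null hypersurface of `(M', h)`: a smooth embedding in
codimension one such that the induced form is degenerate at each point. -/
structure IsNullHypersurface (h : SemiRiemannianMetric F M') (x : M → M') : Prop where
  contMDiff : ContMDiff 𝓘(ℝ, E) 𝓘(ℝ, F) ∞ x
  immersion : ∀ p : M, Function.Injective (diff (E := E) (F := F) x p)
  embedding : Topology.IsEmbedding x
  codim : Module.finrank ℝ F = Module.finrank ℝ E + 1
  degenerate : ∀ p : M, ∃ u : TangentSpace 𝓘(ℝ, E) p,
    u ≠ 0 ∧ ∀ v, inducedForm h.val x p u v = 0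

/-- `N` is a null rigging for the hypersurface `x`: a smooth vector field on an open set containing
`x(M)` (its values outside that set are irrelevant), nowhere tangent to `x(M)` and lightlike at
the points of `x(M)`. -/
structure IsNullRigging (h : SemiRiemannianMetric F M') (x : M → M')
    (N : ∀ q : M', TangentSpace 𝓘(ℝ, F) q) : Prop where
  smooth : ∃ W : Set M', IsOpen W ∧ range x ⊆ W ∧ SmoothFieldOn N W
  transversal : ∀ p : M, N (x p) ∉ range (diff (E := E) (F := F) x p)
  null : ∀ p : M, h.val (x p) (N (x p)) (N (x p)) = 0

variable (h : BilinField F M') (x : M → M') (N : ∀ q : M', TangentSpace 𝓘(ℝ, F) q)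

/-- The `1`-form `η = x^* h(N, ·)` on `M`; the screen distribution is its kernel. -/
def eta : OneForm E M := fun p => (h (x p) (N (x p))).comp (diff (E := E) (F := F) x p)

/-- The metric `g_α = g + α η ⊗ η` on `M`. -/
def alphaMetric (α : M → ℝ) : BilinField E M := fun p =>
  inducedForm h x p + α p • (eta h x N p).smulRight (eta h x N p)

/-- `ξ` is a radical vector of `M` at `p` with `h(ξ, N) = 1`. -/
def IsRiggedVector (p : M) (ξ : TangentSpace 𝓘(ℝ, E) p) : Prop :=
  (∀ v, inducedForm h x p ξ v = 0) ∧ h (x p) (diff (E := E) (F := F) x p ξ) (N (x p)) = 1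

/-- The rigged vector field: the unique section `ξ` of the radical distribution of `M` with
`h(ξ, N) = 1`. -/
def rigged (p : M) : TangentSpace 𝓘(ℝ, E) p := Classical.epsilon (IsRiggedVector h x N p)

/-- The second fundamental form `B(u, Y) = h(∇'_u Y, ξ)` of `M`: the coefficient of `N` in the
decomposition of `∇'_u Y` along `TM ⊕ span N`. -/
def formB (p : M) (u : TangentSpace 𝓘(ℝ, E) p) (Y : ∀ q : M, TangentSpace 𝓘(ℝ, E) q) : ℝ :=
  h (x p) (covDerivAlong (E := E) h x (fun q => diff (E := E) (F := F) x q (Y q)) p u) (diff (E := E) (F := F) x p (rigged h x N p))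

/-- The induced connection `∇_u Y = ∇'_u Y - B(u, Y) N` (as a vector of `dx(T_p M)`). -/
def inducedConnection (p : M) (u : TangentSpace 𝓘(ℝ, E) p)
    (Y : ∀ q : M, TangentSpace 𝓘(ℝ, E) q) : TangentSpace 𝓘(ℝ, F) (x p) :=
  covDerivAlong (E := E) h x (fun q => diff (E := E) (F := F) x q (Y q)) p u - formB (E := E) h x N p u Y • N (x p)

/-- The second fundamental form `C(u, Y) = h(∇_u Y, N)` of the screen distribution, for a section
`Y` of the screen distribution: the coefficient of `ξ` in the decomposition of `∇_u Y` along
`ker η ⊕ span ξ`. -/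
def formC (p : M) (u : TangentSpace 𝓘(ℝ, E) p) (Y : ∀ q : M, TangentSpace 𝓘(ℝ, E) q) : ℝ :=
  h (x p) (inducedConnection (E := E) h x N p u Y) (N (x p))

/-- The rotation `1`-form `τ(u) = h(∇'_u N, ξ)`. -/
def tau (p : M) (u : TangentSpace 𝓘(ℝ, E) p) : ℝ :=
  h (x p) (covDerivAlong (E := E) h x (fun q => N (x q)) p u) (diff (E := E) (F := F) x p (rigged h x N p))

end Hypersurfaces

/-- A hyperplane and a vector outside it span the space. -/
theorem exists_decomposition {E F : Type*} [AddCommGroup E] [Module ℝ E] [AddCommGroup F]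
    [Module ℝ F] [FiniteDimensional ℝ E] [FiniteDimensional ℝ F] (A : E →ₗ[ℝ] F)
    (hA : Function.Injective A) (n : F) (hn : n ∉ range A)
    (hd : Module.finrank ℝ F = Module.finrank ℝ E + 1) (w : F) :
    ∃ (u : E) (c : ℝ), w = A u + c • n := by
  let L : E × ℝ →ₗ[ℝ] F := A.coprod (LinearMap.toSpanSingleton ℝ F n)
  have hL : Function.Injective L := by
    rw [injective_iff_map_eq_zero]
    rintro ⟨u, c⟩ huc
    have h1 : A u + c • n = 0 := by simpa [L] using huc
    have hc : c = 0 := by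
      by_contra hc
      apply hn
      refine ⟨-(c⁻¹ • u), ?_⟩
      have h2 : A u = -(c • n) := eq_neg_of_add_eq_zero_left h1
      rw [map_neg, map_smul, h2, smul_neg, neg_neg, smul_smul, inv_mul_cancel₀ hc, one_smul]
    subst hc
    have h3 : A u = A 0 := by simpa using h1
    rw [hA h3]
    rfl
  have hs : Function.Surjective L :=
    (LinearMap.injective_iff_surjective_of_finrank_eq_finrank (by simp [hd])).1 hL
  obtain ⟨⟨u, c⟩, huc⟩ := hs w
  exact ⟨u, c, by simpa [L] using huc.symm⟩

/-- There is exactly one rigged vector at each point, so that `rigged` is well defined. -/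
theorem rigged_spec {E : Type*} [NormedAddCommGroup E] [NormedSpace ℝ E]
    {M : Type*} [TopologicalSpace M] [ChartedSpace E M] [IsManifold 𝓘(ℝ, E) ∞ M]
    {F : Type*} [NormedAddCommGroup F] [NormedSpace ℝ F]
    {M' : Type*} [TopologicalSpace M'] [ChartedSpace F M'] [IsManifold 𝓘(ℝ, F) ∞ M']
    [FiniteDimensional ℝ E] [FiniteDimensional ℝ F]
    (h : SemiRiemannianMetric F M') (x : M → M') (N : ∀ q : M', TangentSpace 𝓘(ℝ, F) q)
    (hx : IsNullHypersurface (E := E) h x) (hN : IsNullRigging (E := E) h x N) (p : M) :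
    IsRiggedVector h.val x N p (rigged (E := E) h.val x N p) ∧
      ∀ ξ : TangentSpace 𝓘(ℝ, E) p, IsRiggedVector h.val x N p ξ → ξ = rigged h.val x N p := by
  have dec : ∀ w : TangentSpace 𝓘(ℝ, F) (x p), ∃ (u : TangentSpace 𝓘(ℝ, E) p) (c : ℝ),
      w = diff (E := E) (F := F) x p u + c • N (x p) := by
    let D : E →L[ℝ] F := diff (E := E) (F := F) x p
    intro w
    exact exists_decomposition (D : E →ₗ[ℝ] F) (hx.immersion p) (N (x p)) (hN.transversal p)
      hx.codim w
  have key : ∀ d : TangentSpace 𝓘(ℝ, E) p, (∀ v, inducedForm h.val x p d v = 0) →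
      h.val (x p) (diff (E := E) (F := F) x p d) (N (x p)) = 0 → d = 0 := by
    intro d h1 h2
    apply hx.immersion p
    rw [map_zero]
    apply h.nondegenerate
    intro w
    obtain ⟨u, c, rfl⟩ := dec w
    have h3 : h.val (x p) (diff (E := E) (F := F) x p d) (diff (E := E) (F := F) x p u) = 0 := h1 u
    rw [map_add, map_smul, h2, h3, smul_zero, add_zero]
  have ex : ∃ ξ, IsRiggedVector (E := E) h.val x N p ξ := by
    obtain ⟨u, hu, hu0⟩ := hx.degenerate p
    have hc : h.val (x p) (diff (E := E) (F := F) x p u) (N (x p)) ≠ 0 := fun hc => hu (key u hu0 hc)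
    refine ⟨(h.val (x p) (diff (E := E) (F := F) x p u) (N (x p)))⁻¹ • u, fun v => ?_, ?_⟩
    · rw [map_smul, smul_apply, hu0 v, smul_zero]
    · rw [map_smul, map_smul, smul_apply, smul_eq_mul, inv_mul_cancel₀ hc]
  have hr : IsRiggedVector h.val x N p (rigged h.val x N p) := Classical.epsilon_spec ex
  refine ⟨hr, fun ξ hξ => ?_⟩
  rw [← sub_eq_zero]
  apply key
  · intro v
    rw [map_sub, sub_apply, hξ.1 v, hr.1 v, sub_zero]
  · rw [map_sub, map_sub, sub_apply, hξ.2, hr.2, sub_self]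

end NullHyp

end

noncomputable section

namespace NullHyp

set_option maxSynthPendingDepth 3

section CoordinateCalculus

variable {E : Type*} [NormedAddCommGroup E] [NormedSpace ℝ E]
  {F : Type*} [NormedAddCommGroup F] [NormedSpace ℝ F]

theorem contDiffAt_fderiv {f : E → F} {y : E} (hf : ContDiffAt ℝ ∞ f y) :
    ContDiffAt ℝ ∞ (fderiv ℝ f) y :=
  hf.fderiv_right (m := ∞) (by simp)

theorem differentiableAt_of_smooth {f : E → F} {y : E} (hf : ContDiffAt ℝ ∞ f y) :
    DifferentiableAt ℝ f y :=
  hf.differentiableAt (by simp)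

theorem fderiv_fderiv_symm {f : E → F} {y : E} (hf : ContDiffAt ℝ ∞ f y) (u v : E) :
    fderiv ℝ (fderiv ℝ f) y u v = fderiv ℝ (fderiv ℝ f) y v u :=
  (hf.isSymmSndFDerivAt (by simpa using WithTop.coe_le_coe.2 (le_top : (2 : ℕ∞) ≤ ⊤))).eq u v

theorem fderiv_clm_apply_apply {F' : Type*} [NormedAddCommGroup F'] [NormedSpace ℝ F']
    {A : E → F →L[ℝ] F'} {V : E → F} {y : E} (hA : DifferentiableAt ℝ A y)
    (hV : DifferentiableAt ℝ V y) (u : E) :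
    fderiv ℝ (fun z => A z (V z)) y u = fderiv ℝ A y u (V y) + A y (fderiv ℝ V y u) := by
  rw [fderiv_clm_apply hA hV]
  simp [add_comm]

theorem fderiv_apply_const {F' : Type*} [NormedAddCommGroup F'] [NormedSpace ℝ F']
    {A : E → F →L[ℝ] F'} {y : E} (hA : DifferentiableAt ℝ A y) (v : F) (u : E) :
    fderiv ℝ (fun z => A z v) y u = fderiv ℝ A y u v := by
  rw [fderiv_clm_apply_apply hA (differentiableAt_const v)]
  simp

/-- The product rule for a variable bilinear map evaluated at variable vectors. -/
theorem fderiv_bilin_apply {F' F'' : Type*} [NormedAddCommGroup F'] [NormedSpace ℝ F']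
    [NormedAddCommGroup F''] [NormedSpace ℝ F'']
    {A : E → F →L[ℝ] F' →L[ℝ] F''} {V : E → F} {W : E → F'} {y : E}
    (hA : DifferentiableAt ℝ A y) (hV : DifferentiableAt ℝ V y) (hW : DifferentiableAt ℝ W y)
    (u : E) :
    fderiv ℝ (fun z => A z (V z) (W z)) y u =
      fderiv ℝ A y u (V y) (W y) + A y (fderiv ℝ V y u) (W y) + A y (V y) (fderiv ℝ W y u) := by
  rw [fderiv_clm_apply_apply (hA.clm_apply hV) hW, fderiv_clm_apply_apply hA hV]
  simp

theorem isInvertible_of_nondegenerate [FiniteDimensional ℝ E] {A : E →L[ℝ] E →L[ℝ] ℝ}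
    (hA : ∀ u, (∀ v, A u v = 0) → u = 0) : A.IsInvertible := by
  have hinj : Function.Injective (A : E →ₗ[ℝ] E →L[ℝ] ℝ) := by
    rw [injective_iff_map_eq_zero]
    intro u hu
    refine hA u fun v => ?_
    have : A u = 0 := hu
    simp [this]
  have hd : Module.finrank ℝ E = Module.finrank ℝ (E →L[ℝ] ℝ) := by
    rw [← (LinearMap.toContinuousLinearMap : (E →ₗ[ℝ] ℝ) ≃ₗ[ℝ] _).finrank_eq]
    exact (Subspace.dual_finrank_eq (K := ℝ) (V := E)).symm
  exact ⟨(LinearEquiv.ofInjectiveOfFinrankEq _ hinj hd).toContinuousLinearEquiv, by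
    ext; rfl⟩

theorem apply_inverse_apply {A : E →L[ℝ] F} (hA : A.IsInvertible) (l : F) :
    A (A.inverse l) = l := by
  obtain ⟨e, rfl⟩ := hA
  simp

/-- The Christoffel map of a nondegenerate `G` satisfies Koszul's formula. -/
theorem apply_christoffel [FiniteDimensional ℝ E] {G : E → E →L[ℝ] E →L[ℝ] ℝ} {y : E}
    (hA : ∀ u, (∀ v, G y u v = 0) → u = 0) (u v w : E) :
    G y (christoffel G y u v) w =
      1 / 2 * (fderiv ℝ G y u v w + fderiv ℝ G y v u w - fderiv ℝ G y w u v) := by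
  rw [christoffel, map_smul, apply_inverse_apply (isInvertible_of_nondegenerate hA)]
  simp [koszul]

/-- The Christoffel map as a field of continuous bilinear maps. -/
def christoffelL (G : E → E →L[ℝ] E →L[ℝ] ℝ) (y : E) : E →L[ℝ] E →L[ℝ] E :=
  (1 / 2 : ℝ) • (ContinuousLinearMap.compL ℝ E (E →L[ℝ] ℝ) E (G y).inverse).comp
    (fderiv ℝ G y + (fderiv ℝ G y).flip
      - ((ContinuousLinearMap.flipₗᵢ ℝ E E ℝ).toContinuousLinearEquiv :
          (E →L[ℝ] E →L[ℝ] ℝ) →L[ℝ] E →L[ℝ] E →L[ℝ] ℝ).comp (fderiv ℝ G y).flip)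

theorem christoffelL_apply (G : E → E →L[ℝ] E →L[ℝ] ℝ) (y u v : E) :
    christoffelL G y u v = christoffel G y u v := by
  rw [christoffelL, christoffel, koszul]
  simp only [smul_apply, ContinuousLinearMap.comp_apply, ContinuousLinearMap.compL_apply]
  rfl

theorem contDiffAt_christoffelL [FiniteDimensional ℝ E] {G : E → E →L[ℝ] E →L[ℝ] ℝ} {y : E}
    (hG : ContDiffAt ℝ ∞ G y) (hA : ∀ u, (∀ v, G y u v = 0) → u = 0) :
    ContDiffAt ℝ ∞ (christoffelL G) y := by
  have : CompleteSpace E := FiniteDimensional.complete ℝ E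
  have h1 : ContDiffAt ℝ ∞ (fun z => (G z).inverse) y :=
    (isInvertible_of_nondegenerate hA).contDiffAt_map_inverse.comp y hG
  have h2 := contDiffAt_fderiv hG
  have h3 : ContDiffAt ℝ ∞ (fun z => (fderiv ℝ G z).flip) y :=
    (ContinuousLinearMap.flipₗᵢ ℝ E E (E →L[ℝ] ℝ)).toContinuousLinearEquiv.contDiff.contDiffAt.comp
      y h2
  exact (((ContinuousLinearMap.contDiff _).contDiffAt.comp y h1).clm_comp
    ((h2.add h3).sub (contDiffAt_const.clm_comp h3))).const_smul (1 / 2 : ℝ)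

theorem fderiv_symm {G : E → F →L[ℝ] F →L[ℝ] ℝ} {y : E} (hG : DifferentiableAt ℝ G y)
    (hs : ∀ᶠ z in 𝓝 y, ∀ u v, G z u v = G z v u) (w : E) (u v : F) :
    fderiv ℝ G y w u v = fderiv ℝ G y w v u := by
  have h1 : (fun z => G z u v) =ᶠ[𝓝 y] fun z => G z v u := hs.mono fun z hz => hz u v
  have h2 := congrArg (fun L : E →L[ℝ] ℝ => L w) (h1.fderiv_eq (𝕜 := ℝ))
  have h3 := fun a b : F => fderiv_bilin_apply (V := fun _ => a) (W := fun _ => b) hG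
    (differentiableAt_const a) (differentiableAt_const b) w
  simp only [h3] at h2
  simpa using h2

theorem christoffel_symm {G : E → E →L[ℝ] E →L[ℝ] ℝ} {y : E} (hG : DifferentiableAt ℝ G y)
    (hs : ∀ᶠ z in 𝓝 y, ∀ u v, G z u v = G z v u) (u v : E) :
    christoffel G y u v = christoffel G y v u := by
  have : koszul G y u v = koszul G y v u := by
    ext w
    simp [koszul, fderiv_symm hG hs w u v, add_comm]
  rw [christoffel, this, christoffel]

/-- The Levi-Civita connection in coordinates is compatible with the metric. -/
theorem fderiv_metric [FiniteDimensional ℝ E] {G : E → E →L[ℝ] E →L[ℝ] ℝ} {y : E}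
    (hG : DifferentiableAt ℝ G y) (hA : ∀ u, (∀ v, G y u v = 0) → u = 0)
    (hs : ∀ᶠ z in 𝓝 y, ∀ u v, G z u v = G z v u) (u v w : E) :
    fderiv ℝ G y u v w = G y (christoffel G y u v) w + G y v (christoffel G y u w) := by
  rw [hs.self_of_nhds v, apply_christoffel hA, apply_christoffel hA,
    fderiv_symm hG hs u w v, fderiv_symm hG hs w u v, fderiv_symm hG hs v u w]
  ring

/-- The covariant derivative, in coordinates, of a vector field `V` along `f`. -/
def covD (G : F → F →L[ℝ] F →L[ℝ] ℝ) (f V : E → F) (y u : E) : F :=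
  fderiv ℝ V y u + christoffel G (f y) (fderiv ℝ f y u) (V y)

/-- The covariant Hessian of `f`: the covariant derivative of `df(v)`, for constant `v`, in the
direction of `u`. -/
def hess (G : F → F →L[ℝ] F →L[ℝ] ℝ) (f : E → F) (y u v : E) : F :=
  fderiv ℝ (fderiv ℝ f) y u v + christoffel G (f y) (fderiv ℝ f y u) (fderiv ℝ f y v)

/-- Smoothness of `f` and `G`, and symmetry and nondegeneracy of `G`, near a point. -/
structure IsMetricAlong (G : F → F →L[ℝ] F →L[ℝ] ℝ) (f : E → F) (y : E) : Prop where
  map : ContDiffAt ℝ ∞ f y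
  metric : ContDiffAt ℝ ∞ G (f y)
  symm : ∀ᶠ z in 𝓝 (f y), ∀ u v, G z u v = G z v u
  nondeg : ∀ u, (∀ v, G (f y) u v = 0) → u = 0

namespace IsMetricAlong

variable {G : F → F →L[ℝ] F →L[ℝ] ℝ} {f : E → F} {y : E}

theorem comp_metric (h : IsMetricAlong G f y) : ContDiffAt ℝ ∞ (fun z => G (f z)) y :=
  h.metric.comp y h.map

theorem fderiv_comp_metric (h : IsMetricAlong G f y) (u : E) :
    fderiv ℝ (fun z => G (f z)) y u = fderiv ℝ G (f y) (fderiv ℝ f y u) := by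
  have := fderiv_comp y (differentiableAt_of_smooth h.metric) (differentiableAt_of_smooth h.map)
  exact congrArg (fun L => L u) this

theorem hess_symm (h : IsMetricAlong G f y) (u v : E) : hess G f y u v = hess G f y v u := by
  rw [hess, hess, fderiv_fderiv_symm h.map,
    christoffel_symm (differentiableAt_of_smooth h.metric) h.symm]

theorem fderiv_inner [FiniteDimensional ℝ F] (h : IsMetricAlong G f y) {V W : E → F}
    (hV : DifferentiableAt ℝ V y) (hW : DifferentiableAt ℝ W y) (u : E) :
    fderiv ℝ (fun z => G (f z) (V z) (W z)) y u =
      G (f y) (covD G f V y u) (W y) + G (f y) (V y) (covD G f W y u) := by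
  rw [fderiv_bilin_apply (differentiableAt_of_smooth h.comp_metric) hV hW, h.fderiv_comp_metric,
    fderiv_metric (differentiableAt_of_smooth h.metric) h.nondeg h.symm, covD, covD]
  simp only [map_add, add_apply]
  ring

theorem covD_fderiv_apply (h : IsMetricAlong G f y) {T : E → E}
    (hT : DifferentiableAt ℝ T y) (u : E) :
    covD G f (fun z => fderiv ℝ f z (T z)) y u =
      hess G f y u (T y) + fderiv ℝ f y (fderiv ℝ T y u) := by
  rw [covD, hess, fderiv_clm_apply_apply (differentiableAt_of_smooth (contDiffAt_fderiv h.map)) hT]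
  abel

theorem contDiffAt_christoffel_comp [FiniteDimensional ℝ F] (h : IsMetricAlong G f y) :
    ContDiffAt ℝ ∞ (fun z => christoffelL G (f z)) y :=
  (contDiffAt_christoffelL h.metric h.nondeg).comp y h.map

theorem contDiffAt_hess [FiniteDimensional ℝ F] (h : IsMetricAlong G f y) (u v : E) :
    ContDiffAt ℝ ∞ (fun z => hess G f z u v) y := by
  have h1 := contDiffAt_fderiv h.map
  have h2 := ((h.contDiffAt_christoffel_comp).clm_apply (h1.clm_apply (contDiffAt_const (c := u)))
    ).clm_apply (h1.clm_apply (contDiffAt_const (c := v)))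
  simp only [christoffelL_apply] at h2
  exact (((contDiffAt_fderiv h1).clm_apply contDiffAt_const).clm_apply contDiffAt_const).add h2

/-- The Ricci identity for the covariant Hessian of a map. -/
theorem covD_hess_sub [FiniteDimensional ℝ F] (h : IsMetricAlong G f y) (u v w : E) :
    covD G f (fun z => hess G f z v w) y u - covD G f (fun z => hess G f z u w) y v =
      coordCurvature G (f y) (fderiv ℝ f y u) (fderiv ℝ f y v) (fderiv ℝ f y w) := by
  have h1 := contDiffAt_fderiv h.map
  have h2 := contDiffAt_fderiv h1
  have d1 := differentiableAt_of_smooth h1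
  have d2 := differentiableAt_of_smooth h2
  have hc := contDiffAt_christoffelL h.metric h.nondeg
  have dc := differentiableAt_of_smooth hc
  have dcf := differentiableAt_of_smooth h.contDiffAt_christoffel_comp
  have chain : ∀ a : E, fderiv ℝ (fun z => christoffelL G (f z)) y a =
      fderiv ℝ (christoffelL G) (f y) (fderiv ℝ f y a) := fun a =>
    congrArg (fun L => L a) (fderiv_comp y dc (differentiableAt_of_smooth h.map))
  have key : ∀ a b : E, fderiv ℝ (fun z => hess G f z b w) y a =
      fderiv ℝ (fderiv ℝ (fderiv ℝ f)) y a b w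
        + (fderiv ℝ (christoffelL G) (f y) (fderiv ℝ f y a) (fderiv ℝ f y b) (fderiv ℝ f y w)
          + christoffelL G (f y) (fderiv ℝ (fderiv ℝ f) y a b) (fderiv ℝ f y w)
          + christoffelL G (f y) (fderiv ℝ f y b) (fderiv ℝ (fderiv ℝ f) y a w)) := by
    intro a b
    have e1 : (fun z => hess G f z b w) = fun z => fderiv ℝ (fderiv ℝ f) z b w
        + christoffelL G (f z) (fderiv ℝ f z b) (fderiv ℝ f z w) := by
      funext z; rw [hess, christoffelL_apply]
    have db := d1.clm_apply (differentiableAt_const b)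
    have dw := d1.clm_apply (differentiableAt_const w)
    rw [e1, fderiv_fun_add ((d2.clm_apply (differentiableAt_const b)).clm_apply
      (differentiableAt_const w)) ((dcf.clm_apply db).clm_apply dw), add_apply,
      fderiv_bilin_apply dcf db dw, chain, fderiv_apply_const d1, fderiv_apply_const d1,
      fderiv_bilin_apply d2 (differentiableAt_const b) (differentiableAt_const w)]
    simp
  have dG : ∀ a b c : F, fderiv ℝ (fun z => christoffel G z b c) (f y) a =
      fderiv ℝ (christoffelL G) (f y) a b c := by
    intro a b c
    simp only [← christoffelL_apply]
    rw [fderiv_bilin_apply dc (differentiableAt_const b) (differentiableAt_const c)]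
    simp
  rw [covD, covD, key, key, coordCurvature, dG, dG, fderiv_fderiv_symm h1 u v,
    fderiv_fderiv_symm h.map u v]
  simp only [hess, ← christoffelL_apply, map_add]
  abel

end IsMetricAlong

end CoordinateCalculus

section RiggedCoordinates

variable {E : Type*} [NormedAddCommGroup E] [NormedSpace ℝ E]
  {F : Type*} [NormedAddCommGroup F] [NormedSpace ℝ F]

/-- The `1`-form `f^* G(n, ·)` in coordinates. -/
def coordEta (G : F → F →L[ℝ] F →L[ℝ] ℝ) (f n : E → F) (y : E) : E →L[ℝ] ℝ :=
  (G (f y) (n y)).comp (fderiv ℝ f y)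

/-- The form `f^* G + a η ⊗ η` in coordinates. -/
def coordAlpha (G : F → F →L[ℝ] F →L[ℝ] ℝ) (f n : E → F) (a : E → ℝ) (y : E) :
    E →L[ℝ] E →L[ℝ] ℝ :=
  (ContinuousLinearMap.precomp ℝ (fderiv ℝ f y)).comp ((G (f y)).comp (fderiv ℝ f y))
    + a y • (coordEta G f n y).smulRight (coordEta G f n y)

theorem coordEta_apply (G : F → F →L[ℝ] F →L[ℝ] ℝ) (f n : E → F) (y u : E) :
    coordEta G f n y u = G (f y) (n y) (fderiv ℝ f y u) := rfl

theorem coordAlpha_apply (G : F → F →L[ℝ] F →L[ℝ] ℝ) (f n : E → F) (a : E → ℝ) (y u v : E) :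
    coordAlpha G f n a y u v = G (f y) (fderiv ℝ f y u) (fderiv ℝ f y v)
      + a y * (coordEta G f n y u * coordEta G f n y v) := rfl

/-- The coordinate expression, at a point, of a closed rigged null hypersurface and of a
nonvanishing function `a` whose differential vanishes on the screen distribution. -/
structure IsRiggedAt (G : F → F →L[ℝ] F →L[ℝ] ℝ) (f n : E → F) (a : E → ℝ) (y : E) : Prop
    extends IsMetricAlong G f y where
  rig : ContDiffAt ℝ ∞ n y
  fac : ContDiffAt ℝ ∞ a y
  fac_ne : a y ≠ 0
  inj : Function.Injective (fderiv ℝ f y)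
  decomp : ∀ w, ∃ (u : E) (c : ℝ), w = fderiv ℝ f y u + c • n y
  null : G (f y) (n y) (n y) = 0
  radical : ∃ ξ, (∀ v, G (f y) (fderiv ℝ f y ξ) (fderiv ℝ f y v) = 0) ∧
    G (f y) (fderiv ℝ f y ξ) (n y) = 1
  closed : ∀ u v, fderiv ℝ (coordEta G f n) y u v = fderiv ℝ (coordEta G f n) y v u
  leaf : ∀ u, coordEta G f n y u = 0 → fderiv ℝ a y u = 0

/-- The deviation of `f` from being affine for the connections of `coordAlpha` and `G`. -/
def deviation (G : F → F →L[ℝ] F →L[ℝ] ℝ) (f n : E → F) (a : E → ℝ) (y u v : E) : F :=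
  hess G f y u v - fderiv ℝ f y (christoffel (coordAlpha G f n a) y u v)

/-- The second fundamental form of the null hypersurface, for the null vector `ξ`. -/
def sff (G : F → F →L[ℝ] F →L[ℝ] ℝ) (f : E → F) (y ξ u v : E) : ℝ :=
  G (f y) (hess G f y u v) (fderiv ℝ f y ξ)

/-- The shape form `G(∇'_u n, df(v))` of the rigging. -/
def shape (G : F → F →L[ℝ] F →L[ℝ] ℝ) (f n : E → F) (y u v : E) : ℝ :=
  G (f y) (covD G f n y u) (fderiv ℝ f y v)

/-- The coefficient of `ξ` in the difference of the Levi-Civita connection of `coordAlpha` and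
the ambient one. -/
def radicalCoeff (G : F → F →L[ℝ] F →L[ℝ] ℝ) (f n : E → F) (a : E → ℝ) (y ξ u v : E) : ℝ :=
  shape G f n y u v + sff G f y ξ u v / a y
    + fderiv ℝ a y ξ / (2 * a y) * (coordEta G f n y u * coordEta G f n y v)

namespace IsRiggedAt

variable {G : F → F →L[ℝ] F →L[ℝ] ℝ} {f n : E → F} {a : E → ℝ} {y ξ : E}

theorem symm_at (h : IsRiggedAt G f n a y) (u v : F) : G (f y) u v = G (f y) v u :=
  h.symm.self_of_nhds u v

theorem eta_radical (h : IsRiggedAt G f n a y) (hξ : G (f y) (fderiv ℝ f y ξ) (n y) = 1) :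
    coordEta G f n y ξ = 1 := by
  rw [coordEta_apply, h.symm_at, hξ]

theorem fderiv_fac (h : IsRiggedAt G f n a y) (hξ : G (f y) (fderiv ℝ f y ξ) (n y) = 1) (u : E) :
    fderiv ℝ a y u = fderiv ℝ a y ξ * coordEta G f n y u := by
  have h1 := h.leaf (u - coordEta G f n y u • ξ) (by
    rw [map_sub, map_smul, h.eta_radical hξ]; simp)
  rw [map_sub, map_smul, smul_eq_mul, sub_eq_zero] at h1
  rw [h1, mul_comm]

theorem alpha_nondeg (h : IsRiggedAt G f n a y) (u : E)
    (hu : ∀ v, coordAlpha G f n a y u v = 0) : u = 0 := by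
  obtain ⟨ξ, h0, h1⟩ := h.radical
  have e1 : coordEta G f n y u = 0 := by
    have h2 := hu ξ
    rw [coordAlpha_apply, h.symm_at, h0, h.eta_radical h1] at h2
    simpa [h.fac_ne] using h2
  apply h.inj
  rw [map_zero]
  refine h.nondeg _ fun w => ?_
  obtain ⟨v, c, rfl⟩ := h.decomp w
  have h3 := hu v
  rw [coordAlpha_apply, e1] at h3
  rw [coordEta_apply, h.symm_at] at e1
  rw [map_add, map_smul, e1]
  simpa using h3

theorem contDiffAt_eta (h : IsRiggedAt G f n a y) : ContDiffAt ℝ ∞ (coordEta G f n) y :=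
  (h.comp_metric.clm_apply h.rig).clm_comp (contDiffAt_fderiv h.map)

theorem contDiffAt_alpha (h : IsRiggedAt G f n a y) : ContDiffAt ℝ ∞ (coordAlpha G f n a) y := by
  have h1 := contDiffAt_fderiv h.map
  have h2 : ContDiffAt ℝ ∞
      (fun z => ContinuousLinearMap.precomp ℝ (σ := RingHom.id ℝ) (fderiv ℝ f z)) y :=
    ((ContinuousLinearMap.compL ℝ E F ℝ).flip.contDiff).contDiffAt.comp y h1
  exact (h2.clm_comp (h.comp_metric.clm_comp h1)).add
    (h.fac.smul (h.contDiffAt_eta.smulRight h.contDiffAt_eta))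

theorem sff_symm (h : IsRiggedAt G f n a y) (u v : E) :
    sff G f y ξ u v = sff G f y ξ v u := by
  rw [sff, h.hess_symm, sff]

theorem contDiffAt_christoffel [FiniteDimensional ℝ E] (h : IsRiggedAt G f n a y) (u v : E) :
    ContDiffAt ℝ ∞ (fun z => christoffel (coordAlpha G f n a) z u v) y := by
  have h2 := ((contDiffAt_christoffelL h.contDiffAt_alpha h.alpha_nondeg).clm_apply
    (contDiffAt_const (c := u))).clm_apply (contDiffAt_const (c := v))
  simpa only [christoffelL_apply] using h2

/-- The field `ξ` is smooth. -/
theorem exists_radicalField [FiniteDimensional ℝ E]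
    (h : ∀ᶠ z in 𝓝 y, IsRiggedAt G f n a z) :
    ∃ Ξ : E → E, ContDiffAt ℝ ∞ Ξ y ∧
      ∀ᶠ z in 𝓝 y, ∀ v, G (f z) (fderiv ℝ f z (Ξ z)) (fderiv ℝ f z v) = 0 ∧
        G (f z) (fderiv ℝ f z (Ξ z)) (n z) = 1 := by
  have : CompleteSpace E := FiniteDimensional.complete ℝ E
  have hy := h.self_of_nhds
  have hinv : ContDiffAt ℝ ∞ (fun z => (coordAlpha G f n a z).inverse) y :=
    (isInvertible_of_nondegenerate hy.alpha_nondeg).contDiffAt_map_inverse.comp y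
      hy.contDiffAt_alpha
  refine ⟨fun z => a z • (coordAlpha G f n a z).inverse (coordEta G f n z),
    hy.fac.smul (hinv.clm_apply hy.contDiffAt_eta), h.mono fun z hz v => ?_⟩
  obtain ⟨ξ, h0, h1⟩ := hz.radical
  have : a z • (coordAlpha G f n a z).inverse (coordEta G f n z) = ξ := by
    rw [← sub_eq_zero]
    refine hz.alpha_nondeg _ fun w => ?_
    rw [map_sub, map_smul,
      apply_inverse_apply (isInvertible_of_nondegenerate hz.alpha_nondeg), sub_apply, smul_apply,
      coordAlpha_apply, h0, hz.eta_radical h1]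
    simp
  simp only [this]
  exact ⟨h0 v, h1⟩

variable [FiniteDimensional ℝ F]

theorem fderiv_eta (h : IsRiggedAt G f n a y) (u v : E) :
    fderiv ℝ (coordEta G f n) y u v = shape G f n y u v + G (f y) (n y) (hess G f y u v) := by
  have h1 := differentiableAt_of_smooth h.contDiffAt_eta
  rw [← fderiv_apply_const h1]
  have h2 := h.fderiv_inner (V := n) (W := fun z => fderiv ℝ f z v)
    (differentiableAt_of_smooth h.rig)
    ((differentiableAt_of_smooth (contDiffAt_fderiv h.map)).clm_apply (differentiableAt_const v)) u
  have h3 := h.covD_fderiv_apply (differentiableAt_const v) u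
  simp only [fderiv_fun_const, Pi.zero_apply, zero_apply, map_zero, add_zero] at h3
  rw [h3] at h2
  exact h2

theorem shape_symm (h : IsRiggedAt G f n a y) (u v : E) :
    shape G f n y u v = shape G f n y v u := by
  have h1 := h.closed u v
  rw [h.fderiv_eta, h.fderiv_eta, h.hess_symm] at h1
  exact add_right_cancel h1

theorem fderiv_alpha (h : IsRiggedAt G f n a y) (u v w : E) :
    fderiv ℝ (coordAlpha G f n a) y u v w =
      G (f y) (hess G f y u v) (fderiv ℝ f y w) + G (f y) (fderiv ℝ f y v) (hess G f y u w)
        + (fderiv ℝ a y u * (coordEta G f n y v * coordEta G f n y w)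
          + a y * (fderiv ℝ (coordEta G f n) y u v * coordEta G f n y w
            + coordEta G f n y v * fderiv ℝ (coordEta G f n) y u w)) := by
  have d1 := differentiableAt_of_smooth (contDiffAt_fderiv h.map)
  have de := differentiableAt_of_smooth h.contDiffAt_eta
  have da := differentiableAt_of_smooth h.fac
  have dv := d1.clm_apply (differentiableAt_const v)
  have dw := d1.clm_apply (differentiableAt_const w)
  have ev := de.clm_apply (differentiableAt_const v)
  have ew := de.clm_apply (differentiableAt_const w)
  have hc : ∀ b : E, covD G f (fun z => fderiv ℝ f z b) y u = hess G f y u b := fun b => by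
    simpa using h.covD_fderiv_apply (differentiableAt_const b) u
  have e0 : fderiv ℝ (coordAlpha G f n a) y u v w =
      fderiv ℝ (fun z => coordAlpha G f n a z v w) y u := by
    rw [fderiv_bilin_apply (differentiableAt_of_smooth h.contDiffAt_alpha)
      (differentiableAt_const v) (differentiableAt_const w)]
    simp
  have hg : DifferentiableAt ℝ (fun z => G (f z) (fderiv ℝ f z v) (fderiv ℝ f z w)) y :=
    ((differentiableAt_of_smooth h.comp_metric).clm_apply dv).clm_apply dw
  rw [e0]
  simp only [coordAlpha_apply]
  rw [fderiv_fun_add hg (da.fun_mul (ev.fun_mul ew)), add_apply, h.fderiv_inner dv dw, hc, hc,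
    fderiv_fun_mul da (ev.fun_mul ew), fderiv_fun_mul ev ew]
  simp only [add_apply, smul_apply, smul_eq_mul, fderiv_apply_const de]
  ring

variable [FiniteDimensional ℝ E]

theorem alpha_christoffel (h : IsRiggedAt G f n a y)
    (hξ : G (f y) (fderiv ℝ f y ξ) (n y) = 1) (u v w : E) :
    coordAlpha G f n a y (christoffel (coordAlpha G f n a) y u v) w =
      G (f y) (hess G f y u v) (fderiv ℝ f y w)
        + (1 / 2 * fderiv ℝ a y ξ * (coordEta G f n y u * coordEta G f n y v)
          + a y * fderiv ℝ (coordEta G f n) y u v) * coordEta G f n y w := by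
  rw [apply_christoffel h.alpha_nondeg, h.fderiv_alpha, h.fderiv_alpha, h.fderiv_alpha,
    h.closed v u, h.closed w u, h.closed w v, h.hess_symm v u, h.hess_symm w u, h.hess_symm w v,
    h.fderiv_fac hξ u, h.fderiv_fac hξ v, h.fderiv_fac hξ w,
    h.symm_at (fderiv ℝ f y v) (hess G f y u w), h.symm_at (fderiv ℝ f y u) (hess G f y v w)]
  ring

section

variable (h : IsRiggedAt G f n a y)
  (h0 : ∀ v, G (f y) (fderiv ℝ f y ξ) (fderiv ℝ f y v) = 0)
  (h1 : G (f y) (fderiv ℝ f y ξ) (n y) = 1)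

include h h0 h1

theorem eta_christoffel (u v : E) :
    coordEta G f n y (christoffel (coordAlpha G f n a) y u v) =
      sff G f y ξ u v / a y
        + fderiv ℝ a y ξ / (2 * a y) * (coordEta G f n y u * coordEta G f n y v)
        + fderiv ℝ (coordEta G f n) y u v := by
  have h2 := h.alpha_christoffel h1 u v ξ
  rw [coordAlpha_apply, h.symm_at, h0, h.eta_radical h1] at h2
  have h3 := h.fac_ne
  rw [sff]
  field_simp
  linear_combination 2 * h2

theorem deviation_tangent (u v w : E) :
    G (f y) (deviation G f n a y u v) (fderiv ℝ f y w) =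
      sff G f y ξ u v * coordEta G f n y w := by
  have h2 := h.alpha_christoffel h1 u v w
  rw [coordAlpha_apply, h.eta_christoffel h0 h1] at h2
  have h3 := h.fac_ne
  rw [deviation, map_sub, sub_apply]
  field_simp at h2
  linear_combination (-1 / 2) * h2

theorem deviation_rig (u v : E) :
    G (f y) (deviation G f n a y u v) (n y) = -radicalCoeff G f n a y ξ u v := by
  have h2 := h.eta_christoffel h0 h1 u v
  rw [h.fderiv_eta, coordEta_apply] at h2
  rw [h.symm_at, deviation, map_sub, h2, radicalCoeff]
  ring

theorem deviation_deviation (u v u' v' : E) :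
    G (f y) (deviation G f n a y u v) (deviation G f n a y u' v') =
      -(sff G f y ξ u v * radicalCoeff G f n a y ξ u' v'
        + radicalCoeff G f n a y ξ u v * sff G f y ξ u' v') := by
  obtain ⟨t, c, ht⟩ := h.decomp (deviation G f n a y u v)
  have h2 := h.deviation_tangent h0 h1 u v ξ
  have h3 := h.deviation_rig h0 h1 u v
  rw [ht, map_add, map_smul, add_apply, smul_apply, smul_eq_mul] at h2 h3 ⊢
  rw [h.symm_at, h0, h.symm_at (n y), h1, h.eta_radical h1] at h2
  rw [h.null, h.symm_at, ← coordEta_apply] at h3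
  rw [h.symm_at, h.deviation_tangent h0 h1, h.symm_at, h.deviation_rig h0 h1]
  linear_combination (sff G f y ξ u' v') * h3 - (radicalCoeff G f n a y ξ u' v') * h2

end

theorem contDiffAt_deviation (h : IsRiggedAt G f n a y) (u v : E) :
    ContDiffAt ℝ ∞ (fun z => deviation G f n a z u v) y :=
  (h.contDiffAt_hess u v).sub ((contDiffAt_fderiv h.map).clm_apply (h.contDiffAt_christoffel u v))

variable (h : ∀ᶠ z in 𝓝 y, IsRiggedAt G f n a z)
  (h0 : ∀ v, G (f y) (fderiv ℝ f y ξ) (fderiv ℝ f y v) = 0)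
  (h1 : G (f y) (fderiv ℝ f y ξ) (n y) = 1)

include h h0 h1

theorem sff_radical (u : E) : sff G f y ξ u ξ = 0 := by
  have hy := h.self_of_nhds
  obtain ⟨Ξ, hs, hΞ⟩ := exists_radicalField h
  have dΞ := differentiableAt_of_smooth hs
  have hΞy : Ξ y = ξ := by
    rw [← sub_eq_zero]
    refine hy.alpha_nondeg _ fun w => ?_
    rw [coordAlpha_apply, map_sub, map_sub, map_sub, sub_apply, (hΞ.self_of_nhds w).1, h0,
      hy.eta_radical h1, hy.eta_radical (hΞ.self_of_nhds w).2]
    simp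
  have dV := (differentiableAt_of_smooth (contDiffAt_fderiv hy.map)).clm_apply dΞ
  have h2 := hy.fderiv_inner dV dV u
  have h3 : (fun z => G (f z) (fderiv ℝ f z (Ξ z)) (fderiv ℝ f z (Ξ z))) =ᶠ[𝓝 y] fun _ => 0 :=
    hΞ.mono fun z hz => (hz (Ξ z)).1
  rw [h3.fderiv_eq, hy.covD_fderiv_apply dΞ, hΞy, map_add, map_add, add_apply, h0,
    hy.symm_at _ (fderiv ℝ f y ξ), hy.symm_at (fderiv ℝ f y (fderiv ℝ Ξ y u)), h0] at h2
  rw [sff, hy.symm_at]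
  simp only [fderiv_fun_const, Pi.zero_apply, zero_apply, add_zero] at h2
  linarith

theorem covD_deviation_tangent (u v w z : E) (hz : coordEta G f n y z = 0) :
    G (f y) (covD G f (fun t => deviation G f n a t v w) y u) (fderiv ℝ f y z) =
      sff G f y ξ v w * shape G f n y u z + radicalCoeff G f n a y ξ v w * sff G f y ξ u z := by
  have hy := h.self_of_nhds
  have d1 := differentiableAt_of_smooth (contDiffAt_fderiv hy.map)
  have dQ := differentiableAt_of_smooth (hy.contDiffAt_deviation v w)
  have de := differentiableAt_of_smooth hy.contDiffAt_eta
  have dz := d1.clm_apply (differentiableAt_const z)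
  have dx := d1.clm_apply (differentiableAt_const ξ)
  have ez := de.clm_apply (differentiableAt_const z)
  have ex := de.clm_apply (differentiableAt_const ξ)
  have hex := hy.eta_radical h1
  have h2 := hy.fderiv_inner dQ dz u
  have hc : covD G f (fun t => fderiv ℝ f t z) y u = hess G f y u z := by
    simpa using hy.covD_fderiv_apply (differentiableAt_const z) u
  have hne : ∀ᶠ t in 𝓝 y, coordEta G f n t ξ ≠ 0 :=
    ex.continuousAt.eventually_ne (by rw [hex]; exact one_ne_zero)
  have hmul : (fun t => G (f t) (deviation G f n a t v w) (fderiv ℝ f t z) * coordEta G f n t ξ)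
      =ᶠ[𝓝 y] fun t => G (f t) (deviation G f n a t v w) (fderiv ℝ f t ξ) * coordEta G f n t z := by
    filter_upwards [h] with t ht
    obtain ⟨ζ, hz0, hz1⟩ := ht.radical
    rw [ht.deviation_tangent hz0 hz1, ht.deviation_tangent hz0 hz1]
    ring
  have dG := differentiableAt_of_smooth hy.comp_metric
  have h3 := congrArg (fun L : E →L[ℝ] ℝ => L u) (hmul.fderiv_eq (𝕜 := ℝ))
  rw [fderiv_fun_mul ((dG.clm_apply dQ).clm_apply dz) ex,
    fderiv_fun_mul ((dG.clm_apply dQ).clm_apply dx) ez] at h3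
  simp only [add_apply, smul_apply, smul_eq_mul, hy.deviation_tangent h0 h1, hz, hex, mul_zero,
    zero_mul, zero_add, add_zero, one_mul, mul_one, fderiv_apply_const de] at h3
  have h4 : hess G f y u z = deviation G f n a y u z
      + fderiv ℝ f y (christoffel (coordAlpha G f n a) y u z) := by
    rw [deviation, sub_add_cancel]
  rw [h3, hc, h4, map_add, hy.deviation_deviation h0 h1, hy.deviation_tangent h0 h1,
    hy.eta_christoffel h0 h1, hy.fderiv_eta, hz] at h2
  have h6 : radicalCoeff G f n a y ξ u z = shape G f n y u z + sff G f y ξ u z / a y := by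
    rw [radicalCoeff, hz]; ring
  rw [h6] at h2
  linear_combination -h2

/-- The Gauss equation relating the curvatures of `coordAlpha` and `G`. -/
theorem gauss (u v w z : E) (hz : coordEta G f n y z = 0) :
    G (f y) (coordCurvature G (f y) (fderiv ℝ f y u) (fderiv ℝ f y v) (fderiv ℝ f y w))
        (fderiv ℝ f y z) =
      coordAlpha G f n a y (coordCurvature (coordAlpha G f n a) y u v w) z
        + (sff G f y ξ v w * shape G f n y u z + radicalCoeff G f n a y ξ v w * sff G f y ξ u z)
        - (sff G f y ξ u w * shape G f n y v z + radicalCoeff G f n a y ξ u w * sff G f y ξ v z) := by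
  have hy := h.self_of_nhds
  have key : ∀ u v : E, covD G f (fun t => hess G f t v w) y u =
      covD G f (fun t => deviation G f n a t v w) y u
        + deviation G f n a y u (christoffel (coordAlpha G f n a) y v w)
        + fderiv ℝ f y (fderiv ℝ (fun t => christoffel (coordAlpha G f n a) t v w) y u
          + christoffel (coordAlpha G f n a) y u (christoffel (coordAlpha G f n a) y v w)) := by
    intro u v
    have dc := differentiableAt_of_smooth (hy.contDiffAt_christoffel v w)
    have e1 := hy.covD_fderiv_apply dc u
    have e2 : (fun t => hess G f t v w) = fun t => deviation G f n a t v w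
        + fderiv ℝ f t (christoffel (coordAlpha G f n a) t v w) := by
      funext t
      rw [deviation, sub_add_cancel]
    have e3 : covD G f (fun t => hess G f t v w) y u =
        covD G f (fun t => deviation G f n a t v w) y u
          + covD G f (fun t => fderiv ℝ f t (christoffel (coordAlpha G f n a) t v w)) y u := by
      rw [e2, covD, covD, covD, fderiv_fun_add
        (differentiableAt_of_smooth (hy.contDiffAt_deviation v w))
        ((differentiableAt_of_smooth (contDiffAt_fderiv hy.map)).clm_apply dc), add_apply]
      simp only [← christoffelL_apply, map_add]
      abel
    rw [e3, e1, deviation, map_add]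
    abel
  have hR := hy.covD_hess_sub u v w
  rw [key u v, key v u] at hR
  rw [← hR, coordAlpha_apply, hz, coordCurvature]
  simp only [map_add, map_sub, add_apply, sub_apply, hy.deviation_tangent h0 h1, hz,
    covD_deviation_tangent h h0 h1 _ _ _ _ hz]
  ring

/-- The curvature of a plane containing the null direction. -/
theorem alpha_curvature_radical (u : E) (hu : coordEta G f n y u = 0) :
    coordAlpha G f n a y (coordCurvature (coordAlpha G f n a) y ξ u ξ) u =
      G (f y) (coordCurvature G (f y) (fderiv ℝ f y ξ) (fderiv ℝ f y u) (fderiv ℝ f y ξ))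
          (fderiv ℝ f y u)
        + (shape G f n y ξ ξ + 1 / (2 * a y) * fderiv ℝ a y ξ) * sff G f y ξ u u := by
  have hy := h.self_of_nhds
  have h2 := sff_radical h h0 h1
  have h3 := h2 u
  rw [hy.sff_symm] at h3
  rw [gauss h h0 h1 ξ u ξ u hu, radicalCoeff, radicalCoeff, h2, h2, h3, hy.eta_radical h1]
  ring

/-- The curvature of a screen plane. -/
theorem alpha_curvature_screen (u v : E) (hu : coordEta G f n y u = 0)
    (hv : coordEta G f n y v = 0) :
    coordAlpha G f n a y (coordCurvature (coordAlpha G f n a) y u v u) v =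
      G (f y) (coordCurvature G (f y) (fderiv ℝ f y u) (fderiv ℝ f y v) (fderiv ℝ f y u))
          (fderiv ℝ f y v)
        + (sff G f y ξ u u * sff G f y ξ v v - sff G f y ξ u v ^ 2) / a y
        - 2 * sff G f y ξ u v * shape G f n y u v + sff G f y ξ u u * shape G f n y v v
        + sff G f y ξ v v * shape G f n y u u := by
  have hy := h.self_of_nhds
  rw [gauss h h0 h1 u v u v hv, radicalCoeff, radicalCoeff, hu, hv, hy.sff_symm v u,
    hy.shape_symm v u]
  ring

end IsRiggedAt

end RiggedCoordinates

section TangentCurves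

variable {E : Type*} [NormedAddCommGroup E] [NormedSpace ℝ E] [CompleteSpace E]

/-- A vector in the kernel of a nowhere vanishing smooth `1`-form is the velocity of a curve all of
whose points are endpoints of globally defined curves tangent to the kernel of the form. -/
theorem exists_curves_tangent_ker {η : E → E →L[ℝ] ℝ} {y u ζ : E} (hη : ContDiffAt ℝ ∞ η y)
    (hu : η y u = 0) (hζ : η y ζ ≠ 0) {O : Set E} (hO : O ∈ 𝓝 y) :
    ∃ γ : ℝ → E, HasDerivAt γ u 0 ∧ γ 0 = y ∧ ∀ᶠ c in 𝓝 (0 : ℝ), ∃ σ : ℝ → E,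
      ContDiff ℝ 1 σ ∧ (∀ t, σ t ∈ O ∧ η (σ t) (deriv σ t) = 0) ∧ σ 0 = y ∧ σ 1 = γ c := by
  let V : E → E := fun z => u - (η z u / η z ζ) • ζ
  have hV : ContDiffAt ℝ 1 V y := by
    refine ContDiffAt.of_le (n := ∞) ?_ (by simp)
    exact contDiffAt_const.sub (((hη.clm_apply contDiffAt_const).div
      (hη.clm_apply contDiffAt_const) hζ).smul contDiffAt_const)
  have hVy : V y = u := by simp [V, hu]
  have hgood : ∀ᶠ z in 𝓝 y, z ∈ O ∧ η z ζ ≠ 0 ∧ ContinuousAt V z := by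
    have h1 : ∀ᶠ z in 𝓝 y, η z ζ ≠ 0 :=
      (hη.clm_apply contDiffAt_const).continuousAt.eventually_ne hζ
    have h2 : ∀ᶠ z in 𝓝 y, ContDiffAt ℝ 1 V z := hV.eventually (by simp)
    filter_upwards [hO, h1, h2] with z a b c using ⟨a, b, c.continuousAt⟩
  obtain ⟨γ, hγ0, ε, hε, hγ⟩ :=
    hV.exists_forall_mem_closedBall_exists_eq_forall_mem_Ioo_hasDerivAt₀ 0
  simp only [zero_sub, zero_add] at hγ
  have hd0 : HasDerivAt γ u 0 := by
    have := hγ 0 ⟨by linarith, hε⟩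
    rwa [hγ0, hVy] at this
  refine ⟨γ, hd0, hγ0, ?_⟩
  have hpre : ∀ᶠ s in 𝓝 (0 : ℝ), γ s ∈ O ∧ η (γ s) ζ ≠ 0 ∧ ContinuousAt V (γ s) := by
    have := hd0.continuousAt
    rw [ContinuousAt, hγ0] at this
    exact this.eventually hgood
  obtain ⟨δ, hδ, hball⟩ := Metric.eventually_nhds_iff.1 hpre
  have hnear : ∀ᶠ c in 𝓝 (0 : ℝ), |c| < min ε δ := by
    have := Metric.ball_mem_nhds (0 : ℝ) (lt_min hε hδ)
    filter_upwards [this] with c hc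
    simpa using hc
  filter_upwards [hnear] with c hc
  have hs : ∀ t : ℝ, |c * Real.sin (Real.pi / 2 * t)| < min ε δ := fun t => by
    rw [abs_mul]
    exact (mul_le_of_le_one_right (abs_nonneg c) (Real.abs_sin_le_one _)).trans_lt hc
  have hin : ∀ t : ℝ, c * Real.sin (Real.pi / 2 * t) ∈ Ioo (-ε) ε := fun t =>
    abs_lt.1 ((hs t).trans_le (min_le_left _ _))
  have hpt : ∀ t : ℝ, γ (c * Real.sin (Real.pi / 2 * t)) ∈ O ∧
      η (γ (c * Real.sin (Real.pi / 2 * t))) ζ ≠ 0 ∧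
      ContinuousAt V (γ (c * Real.sin (Real.pi / 2 * t))) := fun t => by
    refine hball ?_
    rw [Real.dist_eq, sub_zero]
    exact (hs t).trans_le (min_le_right _ _)
  have hder : ∀ t : ℝ, HasDerivAt (fun t => γ (c * Real.sin (Real.pi / 2 * t)))
      ((c * (Real.cos (Real.pi / 2 * t) * (Real.pi / 2))) •
        V (γ (c * Real.sin (Real.pi / 2 * t)))) t := fun t => by
    have h1 : HasDerivAt (fun t : ℝ => Real.pi / 2 * t) (Real.pi / 2) t := by
      simpa using (hasDerivAt_id t).const_mul (Real.pi / 2)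
    exact (hγ _ (hin t)).scomp t (h1.sin.const_mul c)
  refine ⟨fun t => γ (c * Real.sin (Real.pi / 2 * t)), ?_, fun t => ⟨(hpt t).1, ?_⟩, ?_, ?_⟩
  · rw [contDiff_one_iff_deriv]
    refine ⟨fun t => (hder t).differentiableAt, ?_⟩
    have : deriv (fun t => γ (c * Real.sin (Real.pi / 2 * t))) = fun t =>
        (c * (Real.cos (Real.pi / 2 * t) * (Real.pi / 2))) •
          V (γ (c * Real.sin (Real.pi / 2 * t))) := funext fun t => (hder t).deriv
    rw [this]
    refine Continuous.smul (by fun_prop) (continuous_iff_continuousAt.2 fun t => ?_)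
    exact ContinuousAt.comp (f := fun t => γ (c * Real.sin (Real.pi / 2 * t))) (hpt t).2.2
      (hder t).continuousAt
  · have := (hpt t).2.1
    rw [(hder t).deriv, map_smul]
    simp only [V, map_sub, map_smul, smul_eq_mul]
    rw [div_mul_cancel₀ _ this, sub_self, mul_zero]
  · simpa using hγ0
  · simp

end TangentCurves

section Charts

variable {E : Type*} [NormedAddCommGroup E] [NormedSpace ℝ E]
  {M : Type*} [TopologicalSpace M] [ChartedSpace E M] [IsManifold 𝓘(ℝ, E) ∞ M]
  {F : Type*} [NormedAddCommGroup F] [NormedSpace ℝ F]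
  {M' : Type*} [TopologicalSpace M'] [ChartedSpace F M'] [IsManifold 𝓘(ℝ, F) ∞ M']

theorem frame_coframe {c q : M} (hq : q ∈ (extChartAt 𝓘(ℝ, E) c).source)
    (v : TangentSpace 𝓘(ℝ, E) q) : frame c q (coframe c q v) = v :=
  Trivialization.symmL_continuousLinearMapAt _ (by simpa using hq) v

theorem coframe_frame {c q : M} (hq : q ∈ (extChartAt 𝓘(ℝ, E) c).source) (e : E) :
    coframe c q (frame c q e) = e :=
  Trivialization.continuousLinearMapAt_symmL _ (by simpa using hq) e

theorem coframe_self (p : M) (v : TangentSpace 𝓘(ℝ, E) p) : coframe p p v = v := by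
  rw [coframe, TangentBundle.continuousLinearMapAt_trivializationAt_eq_core (by simp)]
  exact (tangentBundleCore 𝓘(ℝ, E) M).coordChange_self _ _ (by simp) v

theorem frame_self (p : M) (e : E) : frame p p e = e := by
  rw [frame, TangentBundle.symmL_trivializationAt_eq_core (by simp)]
  exact (tangentBundleCore 𝓘(ℝ, E) M).coordChange_self _ _ (by simp) e

theorem frame_eq_mfderiv {c : M} {y : E} (hy : y ∈ (extChartAt 𝓘(ℝ, E) c).target) (u : E) :
    frame c ((extChartAt 𝓘(ℝ, E) c).symm y) u =
      mfderiv 𝓘(ℝ, E) 𝓘(ℝ, E) (extChartAt 𝓘(ℝ, E) c).symm y u := by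
  have hq := (extChartAt 𝓘(ℝ, E) c).map_target hy
  rw [frame, TangentBundle.symmL_trivializationAt (by simpa using hq),
    (extChartAt 𝓘(ℝ, E) c).right_inv hy]
  simp only [modelWithCornersSelf_coe, range_id, mfderivWithin_univ]
  rfl

theorem coframe_eq_mfderiv {c q : M} (hq : q ∈ (extChartAt 𝓘(ℝ, E) c).source)
    (v : TangentSpace 𝓘(ℝ, E) q) :
    coframe c q v = mfderiv 𝓘(ℝ, E) 𝓘(ℝ, E) (extChartAt 𝓘(ℝ, E) c) q v := by
  rw [coframe, TangentBundle.continuousLinearMapAt_trivializationAt (by simpa using hq)]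
  rfl

theorem contMDiffAt_chart_symm {c : M} {y : E} (hy : y ∈ (extChartAt 𝓘(ℝ, E) c).target) :
    ContMDiffAt 𝓘(ℝ, E) 𝓘(ℝ, E) ∞ (extChartAt 𝓘(ℝ, E) c).symm y :=
  (contMDiffOn_extChartAt_symm c).contMDiffAt ((isOpen_extChartAt_target c).mem_nhds hy)

/-- The expression of `x : M → M'` in the charts at `c` and `c'`. -/
def chartMap (x : M → M') (c : M) (c' : M') (y : E) : F :=
  extChartAt 𝓘(ℝ, F) c' (x ((extChartAt 𝓘(ℝ, E) c).symm y))

theorem contDiffAt_chartMap {x : M → M'} (hx : ContMDiff 𝓘(ℝ, E) 𝓘(ℝ, F) ∞ x) {c : M} {c' : M'}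
    {y : E} (hy : y ∈ (extChartAt 𝓘(ℝ, E) c).target)
    (hxy : x ((extChartAt 𝓘(ℝ, E) c).symm y) ∈ (extChartAt 𝓘(ℝ, F) c').source) :
    ContDiffAt ℝ ∞ (chartMap (E := E) (F := F) x c c') y := by
  rw [← contMDiffAt_iff_contDiffAt]
  exact (contMDiffAt_extChartAt' (by simpa using hxy)).comp y
    (hx.contMDiffAt.comp y (contMDiffAt_chart_symm hy))

theorem fderiv_chartMap {x : M → M'} (hx : ContMDiff 𝓘(ℝ, E) 𝓘(ℝ, F) ∞ x) {c : M} {c' : M'}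
    {y : E} (hy : y ∈ (extChartAt 𝓘(ℝ, E) c).target)
    (hxy : x ((extChartAt 𝓘(ℝ, E) c).symm y) ∈ (extChartAt 𝓘(ℝ, F) c').source) (u : E) :
    fderiv ℝ (chartMap (E := E) (F := F) x c c') y u =
      coframe c' (x ((extChartAt 𝓘(ℝ, E) c).symm y))
        (diff (E := E) (F := F) x ((extChartAt 𝓘(ℝ, E) c).symm y)
          (frame c ((extChartAt 𝓘(ℝ, E) c).symm y) u)) := by
  have d1 := (contMDiffAt_chart_symm hy).mdifferentiableAt (by simp)
  have d2 := (hx.contMDiffAt (x := (extChartAt 𝓘(ℝ, E) c).symm y)).mdifferentiableAt (by simp)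
  have d3 : MDifferentiableAt 𝓘(ℝ, F) 𝓘(ℝ, F) (extChartAt 𝓘(ℝ, F) c')
      (x ((extChartAt 𝓘(ℝ, E) c).symm y)) := mdifferentiableAt_extChartAt (by simpa using hxy)
  rw [coframe_eq_mfderiv hxy, frame_eq_mfderiv hy, ← mfderiv_eq_fderiv]
  have e1 := mfderiv_comp_apply y (d3) (d2.comp y d1) u
  have e2 := mfderiv_comp_apply y d2 d1 u
  rw [e2] at e1
  exact e1

theorem inChart_apply (h : BilinField E M) (c : M) (y u v : E) :
    inChart h c y u v = h ((extChartAt 𝓘(ℝ, E) c).symm y)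
      (frame c ((extChartAt 𝓘(ℝ, E) c).symm y) u)
      (frame c ((extChartAt 𝓘(ℝ, E) c).symm y) v) := rfl

theorem inChart_coframe (h : BilinField E M) {c q : M} (hq : q ∈ (extChartAt 𝓘(ℝ, E) c).source)
    (v w : TangentSpace 𝓘(ℝ, E) q) :
    inChart h c (extChartAt 𝓘(ℝ, E) c q) (coframe c q v) (coframe c q w) = h q v w := by
  rw [inChart_apply]
  have : ∀ q', q' = q → h q' (frame c q' (coframe c q v)) (frame c q' (coframe c q w)) =
      h q v w := by
    rintro _ rfl
    rw [frame_coframe hq, frame_coframe hq]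
  exact this _ ((extChartAt 𝓘(ℝ, E) c).left_inv hq)

/-- The components of a smooth vector field along a map are smooth. -/
theorem contDiffAt_coframe {x : M → M'} {V : ∀ q : M', TangentSpace 𝓘(ℝ, F) q} {W : Set M'}
    (hx : ContMDiff 𝓘(ℝ, E) 𝓘(ℝ, F) ∞ x) (hW : IsOpen W) (hV : SmoothFieldOn V W) {c : M} {c' : M'}
    {y : E} (hy : y ∈ (extChartAt 𝓘(ℝ, E) c).target)
    (hxy : x ((extChartAt 𝓘(ℝ, E) c).symm y) ∈ (extChartAt 𝓘(ℝ, F) c').source)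
    (hyW : x ((extChartAt 𝓘(ℝ, E) c).symm y) ∈ W) :
    ContDiffAt ℝ ∞ (fun z : E => coframe c' (x ((extChartAt 𝓘(ℝ, E) c).symm z))
      (V (x ((extChartAt 𝓘(ℝ, E) c).symm z)))) y := by
  have hVa := hV.contMDiffAt (hW.mem_nhds hyW)
  have hb : x ((extChartAt 𝓘(ℝ, E) c).symm y) ∈
      (trivializationAt F (TangentSpace 𝓘(ℝ, F) : M' → Type _) c').baseSet := by simpa using hxy
  rw [(trivializationAt F (TangentSpace 𝓘(ℝ, F) : M' → Type _) c').contMDiffAt_iff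
    (by simpa using hxy)] at hVa
  have hxc := hx.contMDiffAt.comp y (contMDiffAt_chart_symm hy)
  have h2 := hVa.2.comp y hxc
  rw [← contMDiffAt_iff_contDiffAt]
  refine h2.congr_of_eventuallyEq ?_
  have hn := hxc.continuousAt.eventually
    ((trivializationAt F (TangentSpace 𝓘(ℝ, F) : M' → Type _) c').open_baseSet.mem_nhds hb)
  filter_upwards [hn] with z hz
  exact Trivialization.continuousLinearMapAt_apply_of_mem (R := ℝ) _ hz _

theorem contMDiffAt_frame {c : M} {y : E} (hy : y ∈ (extChartAt 𝓘(ℝ, E) c).target) (u : E) :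
    ContMDiffAt 𝓘(ℝ, E) (𝓘(ℝ, E).prod 𝓘(ℝ, E)) ∞
      (fun z => TotalSpace.mk' E (E := (TangentSpace 𝓘(ℝ, E) : M → Type _))
        ((extChartAt 𝓘(ℝ, E) c).symm z) (frame c ((extChartAt 𝓘(ℝ, E) c).symm z) u)) y := by
  have hq := (extChartAt 𝓘(ℝ, E) c).map_target hy
  rw [(trivializationAt E (TangentSpace 𝓘(ℝ, E) : M → Type _) c).contMDiffAt_iff
    (by simpa using hq)]
  refine ⟨contMDiffAt_chart_symm hy, ?_⟩
  refine (contMDiffAt_const (c := u)).congr_of_eventuallyEq ?_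
  filter_upwards [(isOpen_extChartAt_target c).mem_nhds hy] with z hz
  have hz' := (extChartAt 𝓘(ℝ, E) c).map_target hz
  exact (Trivialization.continuousLinearMapAt_apply_of_mem (R := ℝ) _ (by simpa using hz') _).symm.trans
    (coframe_frame hz' u)

theorem contDiffAt_inChart [FiniteDimensional ℝ E] (h : SemiRiemannianMetric E M) {c : M} {y : E}
    (hy : y ∈ (extChartAt 𝓘(ℝ, E) c).target) : ContDiffAt ℝ ∞ (inChart h.val c) y := by
  have key : ContDiffOn ℝ ∞ (inChart h.val c) (extChartAt 𝓘(ℝ, E) c).target := by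
    rw [contDiffOn_clm_apply]
    intro u
    rw [contDiffOn_clm_apply]
    intro v z hz
    refine ContDiffAt.contDiffWithinAt ?_
    have h1 := ContMDiffAt.clm_bundle_apply₂ (F₁ := E) (F₂ := E) (F₃ := ℝ)
      (E₃ := Bundle.Trivial M ℝ)
      (h.contMDiff.contMDiffAt.comp z (contMDiffAt_chart_symm hz)) (contMDiffAt_frame hz u)
      (contMDiffAt_frame hz v)
    rw [contMDiffAt_totalSpace] at h1
    exact h1.2.contDiffAt
  exact key.contDiffAt ((isOpen_extChartAt_target c).mem_nhds hy)

end Charts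

section ChartExpressions

variable {E : Type*} [NormedAddCommGroup E] [NormedSpace ℝ E]
  {M : Type*} [TopologicalSpace M] [ChartedSpace E M] [IsManifold 𝓘(ℝ, E) ∞ M]
  {F : Type*} [NormedAddCommGroup F] [NormedSpace ℝ F]
  {M' : Type*} [TopologicalSpace M'] [ChartedSpace F M'] [IsManifold 𝓘(ℝ, F) ∞ M']

theorem formInChart_apply (θ : OneForm E M) (c : M) (y u : E) :
    formInChart θ c y u = θ ((extChartAt 𝓘(ℝ, E) c).symm y)
      (frame c ((extChartAt 𝓘(ℝ, E) c).symm y) u) := rfl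

theorem formInChart_coframe (θ : OneForm E M) {c q : M}
    (hq : q ∈ (extChartAt 𝓘(ℝ, E) c).source) (v : TangentSpace 𝓘(ℝ, E) q) :
    formInChart θ c (extChartAt 𝓘(ℝ, E) c q) (coframe c q v) = θ q v := by
  rw [formInChart_apply]
  have : ∀ q', q' = q → θ q' (frame c q' (coframe c q v)) = θ q v := by
    rintro _ rfl
    rw [frame_coframe hq]
  exact this _ ((extChartAt 𝓘(ℝ, E) c).left_inv hq)

omit [IsManifold 𝓘(ℝ, E) ∞ M] in
theorem diff_id (q : M) (v : TangentSpace 𝓘(ℝ, E) q) :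
    diff (E := E) (F := E) (id : M → M) q v = v := by
  rw [diff, mfderiv_id]
  rfl

/-- Closedness of a `1`-form can be checked in every chart. -/
theorem fderiv_formInChart_symm {θ : OneForm E M} (hθ : IsClosedForm θ) {c : M} {y : E}
    (hy : y ∈ (extChartAt 𝓘(ℝ, E) c).target)
    (hd : DifferentiableAt ℝ (formInChart θ ((extChartAt 𝓘(ℝ, E) c).symm y))
      (extChartAt 𝓘(ℝ, E) ((extChartAt 𝓘(ℝ, E) c).symm y) ((extChartAt 𝓘(ℝ, E) c).symm y)))
    (u v : E) :
    fderiv ℝ (formInChart θ c) y u v = fderiv ℝ (formInChart θ c) y v u := by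
  set q := (extChartAt 𝓘(ℝ, E) c).symm y with hq
  let ψ : E → E := chartMap (E := E) (F := E) (id : M → M) c q
  have hqs : id q ∈ (extChartAt 𝓘(ℝ, E) q).source := mem_extChartAt_source q
  have hψ : ContDiffAt ℝ ∞ ψ y := contDiffAt_chartMap contMDiff_id hy hqs
  have hev : formInChart θ c =ᶠ[𝓝 y] fun z => (formInChart θ q (ψ z)).comp (fderiv ℝ ψ z) := by
    have h1 : ∀ᶠ z in 𝓝 y, (extChartAt 𝓘(ℝ, E) c).symm z ∈ (extChartAt 𝓘(ℝ, E) q).source :=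
      (contMDiffAt_chart_symm hy).continuousAt.eventually (extChartAt_source_mem_nhds q)
    filter_upwards [(isOpen_extChartAt_target c).mem_nhds hy, h1] with z hz hz1
    ext w
    have h2 : fderiv ℝ ψ z w = _ := fderiv_chartMap contMDiff_id hz hz1 w
    rw [ContinuousLinearMap.comp_apply, h2, diff_id]
    exact (formInChart_coframe θ hz1 _).symm
  have dψ := differentiableAt_of_smooth hψ
  have d2ψ := differentiableAt_of_smooth (contDiffAt_fderiv hψ)
  have hd' : DifferentiableAt ℝ (formInChart θ q) (ψ y) := hd
  have dθ : DifferentiableAt ℝ (fun z => formInChart θ q (ψ z)) y := hd'.comp y dψ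
  have key : ∀ a b : E, fderiv ℝ (formInChart θ c) y a b =
      fderiv ℝ (formInChart θ q) (ψ y) (fderiv ℝ ψ y a) (fderiv ℝ ψ y b)
        + formInChart θ q (ψ y) (fderiv ℝ (fderiv ℝ ψ) y a b) := by
    intro a b
    rw [hev.fderiv_eq, ← fderiv_apply_const (dθ.clm_comp d2ψ)]
    have h3 := fderiv_clm_apply_apply dθ (d2ψ.clm_apply (differentiableAt_const b)) a
    rw [fderiv_apply_const d2ψ] at h3
    have h4 : fderiv ℝ (fun z => formInChart θ q (ψ z)) y a =
        fderiv ℝ (formInChart θ q) (ψ y) (fderiv ℝ ψ y a) :=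
      congrArg (fun L => L a) (fderiv_comp y hd' dψ)
    rw [h4] at h3
    exact h3
  have hc : fderiv ℝ (formInChart θ q) (ψ y) (fderiv ℝ ψ y u) (fderiv ℝ ψ y v)
      - fderiv ℝ (formInChart θ q) (ψ y) (fderiv ℝ ψ y v) (fderiv ℝ ψ y u) = 0 :=
    hθ q (fderiv ℝ ψ y u) (fderiv ℝ ψ y v)
  rw [key, key, fderiv_fderiv_symm hψ u v, sub_eq_zero.1 hc]

/-- The components, in the chart at `x c`, of a vector field of `M'` along `x`. -/
def chartField (x : M → M') (N : ∀ q : M', TangentSpace 𝓘(ℝ, F) q) (c : M) (y : E) : F :=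
  coframe (x c) (x ((extChartAt 𝓘(ℝ, E) c).symm y)) (N (x ((extChartAt 𝓘(ℝ, E) c).symm y)))

/-- The points of the chart at `c` that `x` maps into the chart at `x c`. -/
def chartDomain (x : M → M') (c : M) : Set E :=
  {y | y ∈ (extChartAt 𝓘(ℝ, E) c).target ∧
    x ((extChartAt 𝓘(ℝ, E) c).symm y) ∈ (extChartAt 𝓘(ℝ, F) (x c)).source}

omit [IsManifold 𝓘(ℝ, E) ∞ M] [IsManifold 𝓘(ℝ, F) ∞ M'] in
theorem center_mem_chartDomain (x : M → M') (c : M) :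
    extChartAt 𝓘(ℝ, E) c c ∈ chartDomain (E := E) (F := F) x c := by
  refine ⟨mem_extChartAt_target c, ?_⟩
  rw [extChartAt_to_inv]
  exact mem_extChartAt_source _

omit [IsManifold 𝓘(ℝ, F) ∞ M'] in
theorem chartDomain_mem_nhds {x : M → M'} (hx : ContMDiff 𝓘(ℝ, E) 𝓘(ℝ, F) ∞ x) {c : M} {y : E}
    (hy : y ∈ chartDomain (E := E) (F := F) x c) : chartDomain (E := E) (F := F) x c ∈ 𝓝 y := by
  have h1 := hx.continuous.continuousAt.comp (contMDiffAt_chart_symm hy.1).continuousAt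
  exact Filter.inter_mem ((isOpen_extChartAt_target c).mem_nhds hy.1)
    (h1.preimage_mem_nhds ((isOpen_extChartAt_source (x c)).mem_nhds hy.2))

section

variable {x : M → M'} (hx : ContMDiff 𝓘(ℝ, E) 𝓘(ℝ, F) ∞ x) {c : M} {y : E}
  (hy : y ∈ chartDomain (E := E) (F := F) x c) (h : BilinField F M')
  (N : ∀ q : M', TangentSpace 𝓘(ℝ, F) q)

include hx hy

theorem inChart_chartMap (u v : E) :
    inChart h (x c) (chartMap (E := E) (F := F) x c (x c) y)
      (fderiv ℝ (chartMap (E := E) (F := F) x c (x c)) y u)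
      (fderiv ℝ (chartMap (E := E) (F := F) x c (x c)) y v) = inChart (inducedForm h x) c y u v := by
  rw [fderiv_chartMap hx hy.1 hy.2, fderiv_chartMap hx hy.1 hy.2]
  exact inChart_coframe h hy.2 _ _

theorem coordEta_chart :
    coordEta (inChart h (x c)) (chartMap (E := E) (F := F) x c (x c)) (chartField x N c) y =
      formInChart (eta h x N) c y := by
  ext u
  rw [coordEta_apply, fderiv_chartMap hx hy.1 hy.2]
  exact inChart_coframe h hy.2 _ _

theorem coordAlpha_chart (α : M → ℝ) :
    coordAlpha (inChart h (x c)) (chartMap (E := E) (F := F) x c (x c)) (chartField x N c)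
        (fun z => α ((extChartAt 𝓘(ℝ, E) c).symm z)) y =
      inChart (alphaMetric h x N α) c y := by
  ext u v
  rw [coordAlpha_apply, inChart_chartMap hx hy, coordEta_chart hx hy]
  rfl

end

/-- A smooth function that is constant on the leaves of `ker θ` has differential zero on
`ker θ`. -/
theorem fderiv_eq_zero_of_constantOnLeaves [CompleteSpace E] {θ : OneForm E M} {α : M → ℝ}
    (hα : ContMDiff 𝓘(ℝ, E) 𝓘(ℝ, ℝ) ∞ α) (hleaf : ConstantOnLeaves θ α) {c : M} {y u ζ : E}
    (hy : y ∈ (extChartAt 𝓘(ℝ, E) c).target) (hθ : ContDiffAt ℝ ∞ (formInChart θ c) y)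
    (hu : formInChart θ c y u = 0) (hζ : formInChart θ c y ζ ≠ 0) :
    fderiv ℝ (fun z => α ((extChartAt 𝓘(ℝ, E) c).symm z)) y u = 0 := by
  have hds : ContDiffAt ℝ ∞ (fun z => α ((extChartAt 𝓘(ℝ, E) c).symm z)) y := by
    rw [← contMDiffAt_iff_contDiffAt]
    exact hα.contMDiffAt.comp y (contMDiffAt_chart_symm hy)
  have hd : DifferentiableAt ℝ (fun z => α ((extChartAt 𝓘(ℝ, E) c).symm z)) y :=
    differentiableAt_of_smooth hds
  obtain ⟨γ, hγ, hγ0, hc⟩ := exists_curves_tangent_ker hθ hu hζ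
    ((isOpen_extChartAt_target c).mem_nhds hy)
  have hconst : (fun s => α ((extChartAt 𝓘(ℝ, E) c).symm (γ s))) =ᶠ[𝓝 0]
      fun _ => α ((extChartAt 𝓘(ℝ, E) c).symm y) := by
    filter_upwards [hc] with s hs
    obtain ⟨σ, hσ, hσt, hσ0, hσ1⟩ := hs
    rw [← hσ1, ← hσ0]
    refine hleaf _ _ ⟨fun t => (extChartAt 𝓘(ℝ, E) c).symm (σ t), fun t => ?_, fun t => ?_, rfl, rfl⟩
    · exact ((contMDiffAt_chart_symm (hσt t).1).of_le (by simp)).comp t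
        hσ.contDiffAt.contMDiffAt
    · have d1 : MDifferentiableAt 𝓘(ℝ, E) 𝓘(ℝ, E) (extChartAt 𝓘(ℝ, E) c).symm (σ t) :=
        (contMDiffAt_chart_symm (hσt t).1).mdifferentiableAt (by simp)
      have d2 : MDifferentiableAt 𝓘(ℝ, ℝ) 𝓘(ℝ, E) σ t :=
        (hσ.differentiable (by simp) t).mdifferentiableAt
      have e1 := mfderiv_comp_apply t d1 d2 (1 : ℝ)
      have e2 : mfderiv 𝓘(ℝ, ℝ) 𝓘(ℝ, E) σ t (1 : ℝ) = deriv σ t := by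
        rw [mfderiv_eq_fderiv]; rfl
      have e3 := (hσt t).2
      rw [formInChart_apply, frame_eq_mfderiv (hσt t).1] at e3
      rw [e2] at e1
      refine (congrArg (θ ((extChartAt 𝓘(ℝ, E) c).symm (σ t))) ?_).trans e3
      exact e1
  have h1 : HasDerivAt (fun s => α ((extChartAt 𝓘(ℝ, E) c).symm (γ s)))
      (fderiv ℝ (fun z => α ((extChartAt 𝓘(ℝ, E) c).symm z)) y u) 0 := by
    rw [← hγ0] at hd ⊢
    exact hd.hasFDerivAt.comp_hasDerivAt 0 hγ
  exact h1.unique ((hasDerivAt_const (0 : ℝ) _).congr_of_eventuallyEq hconst)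

theorem christoffel_congr {G G' : E → E →L[ℝ] E →L[ℝ] ℝ} {y : E} (h : G =ᶠ[𝓝 y] G') (u v : E) :
    christoffel G y u v = christoffel G' y u v := by
  rw [christoffel, christoffel, koszul, koszul, h.fderiv_eq, h.eq_of_nhds]

theorem coordCurvature_congr {G G' : E → E →L[ℝ] E →L[ℝ] ℝ} {y : E} (h : G =ᶠ[𝓝 y] G')
    (u v w : E) : coordCurvature G y u v w = coordCurvature G' y u v w := by
  have h1 : ∀ a b : E, (fun z => christoffel G z a b) =ᶠ[𝓝 y] fun z => christoffel G' z a b :=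
    fun a b => h.eventuallyEq_nhds.mono fun z hz => christoffel_congr hz a b
  rw [coordCurvature, coordCurvature, (h1 v w).fderiv_eq, (h1 u w).fderiv_eq]
  simp only [christoffel_congr h]

theorem covD_congr {G : F → F →L[ℝ] F →L[ℝ] ℝ} {f V V' : E → F} {y : E} (h : V =ᶠ[𝓝 y] V') (u : E) :
    covD G f V y u = covD G f V' y u := by
  rw [covD, covD, h.fderiv_eq, h.eq_of_nhds]

variable [FiniteDimensional ℝ E] [FiniteDimensional ℝ F]

omit [FiniteDimensional ℝ E] in
theorem isMetricAlong_chart (h : SemiRiemannianMetric F M') {x : M → M'}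
    (hx : ContMDiff 𝓘(ℝ, E) 𝓘(ℝ, F) ∞ x) {c : M} {y : E}
    (hy : y ∈ chartDomain (E := E) (F := F) x c) :
    IsMetricAlong (inChart h.val (x c)) (chartMap (E := E) (F := F) x c (x c)) y where
  map := contDiffAt_chartMap hx hy.1 hy.2
  metric := contDiffAt_inChart h ((extChartAt 𝓘(ℝ, F) (x c)).map_source hy.2)
  symm := Filter.Eventually.of_forall fun z u v => h.symm _ _ _
  nondeg := fun u hu => by
    have h1 : frame (x c) (x ((extChartAt 𝓘(ℝ, E) c).symm y)) u = 0 := by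
      refine h.nondegenerate _ _ fun w => ?_
      have h2 := hu (coframe (x c) (x ((extChartAt 𝓘(ℝ, E) c).symm y)) w)
      rw [← coframe_frame hy.2 u] at h2
      exact (inChart_coframe h.val hy.2 _ _).symm.trans h2
    rw [← coframe_frame hy.2 u, h1, map_zero]

omit [FiniteDimensional ℝ E] in
theorem contDiffAt_formInChart_eta (h : SemiRiemannianMetric F M') {x : M → M'}
    (hx : ContMDiff 𝓘(ℝ, E) 𝓘(ℝ, F) ∞ x) {N : ∀ q : M', TangentSpace 𝓘(ℝ, F) q}
    (hN : IsNullRigging (E := E) h x N) {c : M} {y : E}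
    (hy : y ∈ chartDomain (E := E) (F := F) x c) :
    ContDiffAt ℝ ∞ (formInChart (eta (E := E) h.val x N) c) y := by
  obtain ⟨W, hW, hWx, hNW⟩ := hN.smooth
  have h1 := isMetricAlong_chart h hx hy
  have h2 : ContDiffAt ℝ ∞ (coordEta (inChart h.val (x c)) (chartMap (E := E) (F := F) x c (x c))
      (chartField x N c)) y :=
    (h1.comp_metric.clm_apply (contDiffAt_coframe hx hW hNW hy.1 hy.2 (hWx (mem_range_self _)))
      ).clm_comp (contDiffAt_fderiv h1.map)
  refine h2.congr_of_eventuallyEq ?_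
  filter_upwards [chartDomain_mem_nhds hx hy] with z hz
  exact (coordEta_chart hx hz h.val N).symm

/-- A closed rigged null hypersurface, expressed in charts. -/
theorem isRiggedAt_chart (h : SemiRiemannianMetric F M') (x : M → M')
    (hx : IsNullHypersurface (E := E) h x) (N : ∀ q : M', TangentSpace 𝓘(ℝ, F) q)
    (hN : IsNullRigging (E := E) h x N) (hclosed : IsClosedForm (eta (E := E) h.val x N))
    (α : M → ℝ) (hα : ContMDiff 𝓘(ℝ, E) 𝓘(ℝ, ℝ) ∞ α) (hα0 : ∀ p, α p ≠ 0)
    (hleaf : ConstantOnLeaves (eta (E := E) h.val x N) α) {c : M} {y : E}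
    (hy : y ∈ chartDomain (E := E) (F := F) x c) :
    IsRiggedAt (inChart h.val (x c)) (chartMap (E := E) (F := F) x c (x c)) (chartField x N c)
      (fun z => α ((extChartAt 𝓘(ℝ, E) c).symm z)) y := by
  have : CompleteSpace E := FiniteDimensional.complete ℝ E
  set q := (extChartAt 𝓘(ℝ, E) c).symm y with hq
  have hqs : q ∈ (extChartAt 𝓘(ℝ, E) c).source := (extChartAt 𝓘(ℝ, E) c).map_target hy.1
  have hfd : ∀ v : TangentSpace 𝓘(ℝ, E) q,
      fderiv ℝ (chartMap (E := E) (F := F) x c (x c)) y (coframe c q v) =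
        coframe (x c) (x q) (diff (E := E) (F := F) x q v) := fun v => by
    rw [fderiv_chartMap hx.contMDiff hy.1 hy.2, frame_coframe hqs]
  have hev : coordEta (inChart h.val (x c)) (chartMap (E := E) (F := F) x c (x c))
      (chartField x N c) =ᶠ[𝓝 y] formInChart (eta h.val x N) c := by
    filter_upwards [chartDomain_mem_nhds hx.contMDiff hy] with z hz
    exact coordEta_chart hx.contMDiff hz h.val N
  have hξ := (rigged_spec h x N hx hN q).1
  have hr0 : ∀ v, inChart h.val (x c) (chartMap (E := E) (F := F) x c (x c) y)
      (fderiv ℝ (chartMap (E := E) (F := F) x c (x c)) y (coframe c q (rigged h.val x N q)))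
      (fderiv ℝ (chartMap (E := E) (F := F) x c (x c)) y v) = 0 := fun v => by
    rw [← coframe_frame hqs v, hfd, hfd]
    exact (inChart_coframe h.val hy.2 _ _).trans (hξ.1 _)
  have hr1 : inChart h.val (x c) (chartMap (E := E) (F := F) x c (x c) y)
      (fderiv ℝ (chartMap (E := E) (F := F) x c (x c)) y (coframe c q (rigged h.val x N q)))
      (chartField x N c y) = 1 := by
    rw [hfd]
    exact (inChart_coframe h.val hy.2 _ _).trans hξ.2
  obtain ⟨W, hW, hWx, hNW⟩ := hN.smooth
  refine { isMetricAlong_chart h hx.contMDiff hy with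
    rig := contDiffAt_coframe hx.contMDiff hW hNW hy.1 hy.2 (hWx (mem_range_self _))
    fac := ?_
    fac_ne := hα0 _
    inj := ?_
    decomp := ?_
    null := (inChart_coframe h.val hy.2 _ _).trans (hN.null _)
    radical := ⟨_, hr0, hr1⟩
    closed := ?_
    leaf := ?_ }
  · rw [← contMDiffAt_iff_contDiffAt]
    exact hα.contMDiffAt.comp y (contMDiffAt_chart_symm hy.1)
  · rw [injective_iff_map_eq_zero]
    intro u hu
    rw [← coframe_frame hqs u, hfd] at hu
    have h1 : diff (E := E) (F := F) x q (frame c q u) = 0 := by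
      rw [← frame_coframe hy.2 (diff (E := E) (F := F) x q (frame c q u))]
      exact (congrArg (frame (x c) (x q)) hu).trans (map_zero _)
    have h2 : frame c q u = 0 := hx.immersion q (h1.trans (map_zero _).symm)
    rw [← coframe_frame hqs u, h2, map_zero]
  · intro w
    let D : E →L[ℝ] F := diff (E := E) (F := F) x q
    obtain ⟨v, s, hvs⟩ := exists_decomposition (D : E →ₗ[ℝ] F) (hx.immersion q) (N (x q))
      (hN.transversal q) hx.codim (frame (x c) (x q) w)
    refine ⟨coframe c q v, s, ?_⟩
    have h1 : coframe (x c) (x q) (frame (x c) (x q) w) =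
        coframe (x c) (x q) (diff (E := E) (F := F) x q v + s • N (x q)) :=
      congrArg (coframe (x c) (x q)) hvs
    rw [coframe_frame hy.2, map_add, map_smul] at h1
    exact h1.trans (congrArg (fun e => e + s • chartField x N c y) (hfd v).symm)
  · intro u v
    rw [hev.fderiv_eq]
    exact fderiv_formInChart_symm hclosed hy.1 (differentiableAt_of_smooth
      (contDiffAt_formInChart_eta h hx.contMDiff hN (center_mem_chartDomain x q))) u v
  · intro u hu
    rw [hev.eq_of_nhds] at hu
    refine fderiv_eq_zero_of_constantOnLeaves (ζ := coframe c q (rigged h.val x N q)) hα hleaf hy.1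
      (contDiffAt_formInChart_eta h hx.contMDiff hN hy) hu ?_
    rw [← hev.eq_of_nhds, coordEta_apply, (isMetricAlong_chart h hx.contMDiff hy).symm.self_of_nhds,
      hr1]
    exact one_ne_zero

end ChartExpressions

section Center

variable {E : Type*} [NormedAddCommGroup E] [NormedSpace ℝ E]
  {M : Type*} [TopologicalSpace M] [ChartedSpace E M] [IsManifold 𝓘(ℝ, E) ∞ M]
  {F : Type*} [NormedAddCommGroup F] [NormedSpace ℝ F]
  {M' : Type*} [TopologicalSpace M'] [ChartedSpace F M'] [IsManifold 𝓘(ℝ, F) ∞ M']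

theorem inChart_center (h : BilinField E M) (p : M) (u v : E) :
    inChart h p (extChartAt 𝓘(ℝ, E) p p) u v = h p u v :=
  (congrArg₂ (fun a b : E => inChart h p (extChartAt 𝓘(ℝ, E) p p) a b) (coframe_self p u)
    (coframe_self p v)).symm.trans (inChart_coframe h (mem_extChartAt_source p) u v)

theorem formInChart_center (θ : OneForm E M) (p : M) (u : E) :
    formInChart θ p (extChartAt 𝓘(ℝ, E) p p) u = θ p u :=
  (congrArg (fun a : E => formInChart θ p (extChartAt 𝓘(ℝ, E) p p) a) (coframe_self p u)).symm.trans
    (formInChart_coframe θ (mem_extChartAt_source p) u)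

omit [IsManifold 𝓘(ℝ, E) ∞ M] in
theorem mvfderiv_center {α : M → ℝ} {p : M} (hα : MDifferentiableAt 𝓘(ℝ, E) 𝓘(ℝ, ℝ) α p) (u : E) :
    mvfderiv 𝓘(ℝ, E) α p u =
      fderiv ℝ (fun z => α ((extChartAt 𝓘(ℝ, E) p).symm z)) (extChartAt 𝓘(ℝ, E) p p) u := by
  refine (congrArg (fun L : E →L[ℝ] ℝ => L u) hα.mfderiv).trans ?_
  rw [modelWithCornersSelf_coe, range_id, fderivWithin_univ]
  rfl

/-- The sectional curvature computed from the expression of the metric in a chart. -/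
theorem sectionalCurvature_eq {h : BilinField E M} {p : M} {H : E → E →L[ℝ] E →L[ℝ] ℝ}
    (hH : inChart h p =ᶠ[𝓝 (extChartAt 𝓘(ℝ, E) p p)] H) (u v : E) :
    sectionalCurvature h p u v =
      H (extChartAt 𝓘(ℝ, E) p p) (coordCurvature H (extChartAt 𝓘(ℝ, E) p p) u v u) v /
        (H (extChartAt 𝓘(ℝ, E) p p) u u * H (extChartAt 𝓘(ℝ, E) p p) v v
          - H (extChartAt 𝓘(ℝ, E) p p) u v ^ 2) := by
  rw [← coordCurvature_congr hH, ← hH.eq_of_nhds, inChart_center, inChart_center, inChart_center,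
    inChart_center]
  rfl

omit [IsManifold 𝓘(ℝ, E) ∞ M] [IsManifold 𝓘(ℝ, F) ∞ M'] in
theorem chartMap_center (x : M → M') (p : M) :
    chartMap (E := E) (F := F) x p (x p) (extChartAt 𝓘(ℝ, E) p p) =
      extChartAt 𝓘(ℝ, F) (x p) (x p) := by
  rw [chartMap, extChartAt_to_inv]

omit [IsManifold 𝓘(ℝ, E) ∞ M] in
theorem coframe_center (x : M → M') (V : ∀ q : M, TangentSpace 𝓘(ℝ, F) (x q)) (p : M) :
    coframe (x p) (x ((extChartAt 𝓘(ℝ, E) p).symm (extChartAt 𝓘(ℝ, E) p p)))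
      (V ((extChartAt 𝓘(ℝ, E) p).symm (extChartAt 𝓘(ℝ, E) p p))) = V p := by
  have : ∀ q, q = p → coframe (x p) (x q) (V q) = V p := by
    rintro _ rfl
    exact coframe_self _ _
  exact this _ (extChartAt_to_inv p)

theorem fderiv_chartMap_center {x : M → M'} (hx : ContMDiff 𝓘(ℝ, E) 𝓘(ℝ, F) ∞ x) (p : M)
    (u : E) :
    fderiv ℝ (chartMap (E := E) (F := F) x p (x p)) (extChartAt 𝓘(ℝ, E) p p) u =
      diff (E := E) (F := F) x p u := by
  have hy := center_mem_chartDomain (E := E) (F := F) x p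
  rw [fderiv_chartMap hx hy.1 hy.2]
  have : ∀ q, q = p → coframe (x p) (x q) (diff (E := E) (F := F) x q (frame p q u)) =
      diff (E := E) (F := F) x p u := by
    rintro _ rfl
    rw [frame_self]
    exact coframe_self _ _
  exact this _ (extChartAt_to_inv p)

theorem covDerivAlong_eq_covD (h : BilinField F M') {x : M → M'}
    (hx : ContMDiff 𝓘(ℝ, E) 𝓘(ℝ, F) ∞ x) (V : ∀ q : M, TangentSpace 𝓘(ℝ, F) (x q)) (p : M)
    (u : E) :
    covDerivAlong (E := E) h x V p u =
      covD (inChart h (x p)) (chartMap (E := E) (F := F) x p (x p))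
        (fun y : E => coframe (x p) (x ((extChartAt 𝓘(ℝ, E) p).symm y))
          (V ((extChartAt 𝓘(ℝ, E) p).symm y))) (extChartAt 𝓘(ℝ, E) p p) u := by
  rw [covD, chartMap_center, fderiv_chartMap_center hx, coframe_center]
  rfl

omit [IsManifold 𝓘(ℝ, E) ∞ M] in
theorem inner_center (h : BilinField F M') (x : M → M') (p : M) (v w : F) :
    inChart h (x p) (chartMap (E := E) (F := F) x p (x p) (extChartAt 𝓘(ℝ, E) p p)) v w =
      h (x p) v w := by
  rw [chartMap_center, inChart_center]

theorem inner_tangent_center (h : BilinField F M') {x : M → M'}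
    (hx : ContMDiff 𝓘(ℝ, E) 𝓘(ℝ, F) ∞ x) (p : M) (v : F) (w : E) :
    inChart h (x p) (chartMap (E := E) (F := F) x p (x p) (extChartAt 𝓘(ℝ, E) p p)) v
        (fderiv ℝ (chartMap (E := E) (F := F) x p (x p)) (extChartAt 𝓘(ℝ, E) p p) w) =
      h (x p) v (diff (E := E) (F := F) x p w) :=
  (inner_center h x p v _).trans (congrArg (fun a : F => (h (x p) : F →L[ℝ] F →L[ℝ] ℝ) v a)
    (fderiv_chartMap_center hx p w))

theorem inner_tangent_tangent_center (h : BilinField F M') {x : M → M'}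
    (hx : ContMDiff 𝓘(ℝ, E) 𝓘(ℝ, F) ∞ x) (p : M) (v w : E) :
    inChart h (x p) (chartMap (E := E) (F := F) x p (x p) (extChartAt 𝓘(ℝ, E) p p))
        (fderiv ℝ (chartMap (E := E) (F := F) x p (x p)) (extChartAt 𝓘(ℝ, E) p p) v)
        (fderiv ℝ (chartMap (E := E) (F := F) x p (x p)) (extChartAt 𝓘(ℝ, E) p p) w) =
      inducedForm (E := E) h x p v w :=
  (inner_tangent_center h hx p _ w).trans (congrArg (fun a : F =>
    (h (x p) : F →L[ℝ] F →L[ℝ] ℝ) a (diff (E := E) (F := F) x p w))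
    (fderiv_chartMap_center hx p v))

theorem curvature_center (h : BilinField F M') {x : M → M'}
    (hx : ContMDiff 𝓘(ℝ, E) 𝓘(ℝ, F) ∞ x) (p : M) (u v w z : E) :
    inChart h (x p) (chartMap (E := E) (F := F) x p (x p) (extChartAt 𝓘(ℝ, E) p p))
        (coordCurvature (inChart h (x p))
          (chartMap (E := E) (F := F) x p (x p) (extChartAt 𝓘(ℝ, E) p p))
          (fderiv ℝ (chartMap (E := E) (F := F) x p (x p)) (extChartAt 𝓘(ℝ, E) p p) u)
          (fderiv ℝ (chartMap (E := E) (F := F) x p (x p)) (extChartAt 𝓘(ℝ, E) p p) v)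
          (fderiv ℝ (chartMap (E := E) (F := F) x p (x p)) (extChartAt 𝓘(ℝ, E) p p) w))
        (fderiv ℝ (chartMap (E := E) (F := F) x p (x p)) (extChartAt 𝓘(ℝ, E) p p) z) =
      h (x p) (curvature h (x p) (diff (E := E) (F := F) x p u) (diff (E := E) (F := F) x p v)
        (diff (E := E) (F := F) x p w)) (diff (E := E) (F := F) x p z) := by
  rw [inner_tangent_center h hx, fderiv_chartMap_center hx, fderiv_chartMap_center hx,
    fderiv_chartMap_center hx, chartMap_center]
  rfl

theorem contDiffAt_chartField_id {U : Set M} (hU : IsOpen U)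
    {Y : ∀ p : M, TangentSpace 𝓘(ℝ, E) p} (hY : SmoothFieldOn Y U) {p : M} (hp : p ∈ U) :
    ContDiffAt ℝ ∞ (chartField (F := E) (id : M → M) Y p) (extChartAt 𝓘(ℝ, E) p p) :=
  contDiffAt_coframe contMDiff_id hU hY (mem_extChartAt_target p)
    ((extChartAt 𝓘(ℝ, E) p).map_target (mem_extChartAt_target p))
    (by rw [extChartAt_to_inv]; exact hp)

variable [FiniteDimensional ℝ F] (h : SemiRiemannianMetric F M') (x : M → M')

/-- The covariant derivative of a tangent field along the hypersurface, in coordinates. -/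
theorem covDerivAlong_tangent (hx : ContMDiff 𝓘(ℝ, E) 𝓘(ℝ, F) ∞ x) {U : Set M} (hU : IsOpen U)
    {Y : ∀ p : M, TangentSpace 𝓘(ℝ, E) p} (hY : SmoothFieldOn Y U) {p : M} (hp : p ∈ U) (u w : E)
    (hw : Y p = w) :
    (covDerivAlong (E := E) h.val x (fun q => diff (E := E) (F := F) x q (Y q)) p u : F) =
      hess (inChart h.val (x p)) (chartMap (E := E) (F := F) x p (x p))
          (extChartAt 𝓘(ℝ, E) p p) u w
        + fderiv ℝ (chartMap (E := E) (F := F) x p (x p)) (extChartAt 𝓘(ℝ, E) p p)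
          (fderiv ℝ (chartField (F := E) (id : M → M) Y p) (extChartAt 𝓘(ℝ, E) p p) u) := by
  have hy := center_mem_chartDomain (E := E) (F := F) x p
  have hT := contDiffAt_chartField_id hU hY hp
  have hTp : chartField (F := E) (id : M → M) Y p (extChartAt 𝓘(ℝ, E) p p) = w :=
    (coframe_center (E := E) (F := E) (id : M → M) Y p).trans hw
  have hev : (fun y : E => coframe (x p) (x ((extChartAt 𝓘(ℝ, E) p).symm y))
      (diff (E := E) (F := F) x ((extChartAt 𝓘(ℝ, E) p).symm y)
        (Y ((extChartAt 𝓘(ℝ, E) p).symm y)))) =ᶠ[𝓝 (extChartAt 𝓘(ℝ, E) p p)]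
      fun y => fderiv ℝ (chartMap (E := E) (F := F) x p (x p)) y
        (chartField (F := E) (id : M → M) Y p y) := by
    filter_upwards [chartDomain_mem_nhds hx hy] with y hy'
    rw [fderiv_chartMap hx hy'.1 hy'.2]
    exact congrArg (fun e => coframe (x p) _ (diff (E := E) (F := F) x _ e))
      (frame_coframe ((extChartAt 𝓘(ℝ, E) p).map_target hy'.1) _).symm
  have e1 := covDerivAlong_eq_covD (E := E) h.val hx
    (fun q => diff (E := E) (F := F) x q (Y q)) p u
  have e2 := (isMetricAlong_chart h hx hy).covD_fderiv_apply (differentiableAt_of_smooth hT) u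
  rw [hTp] at e2
  exact (e1.trans (covD_congr hev u)).trans e2

variable [FiniteDimensional ℝ E] (hx : IsNullHypersurface (E := E) h x)
  (N : ∀ q : M', TangentSpace 𝓘(ℝ, F) q) (hN : IsNullRigging (E := E) h x N)

include hx hN

theorem rigged_center {p : M} {ξ : E} (hξ : rigged (E := E) h.val x N p = ξ) :
    (∀ v, inChart h.val (x p) (chartMap (E := E) (F := F) x p (x p) (extChartAt 𝓘(ℝ, E) p p))
        (fderiv ℝ (chartMap (E := E) (F := F) x p (x p)) (extChartAt 𝓘(ℝ, E) p p) ξ)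
        (fderiv ℝ (chartMap (E := E) (F := F) x p (x p)) (extChartAt 𝓘(ℝ, E) p p) v) = 0) ∧
      inChart h.val (x p) (chartMap (E := E) (F := F) x p (x p) (extChartAt 𝓘(ℝ, E) p p))
        (fderiv ℝ (chartMap (E := E) (F := F) x p (x p)) (extChartAt 𝓘(ℝ, E) p p) ξ)
        (chartField x N p (extChartAt 𝓘(ℝ, E) p p)) = 1 := by
  have hr := (rigged_spec h x N hx hN p).1
  subst hξ
  refine ⟨fun v => (inner_tangent_tangent_center h.val hx.contMDiff p _ v).trans (hr.1 v), ?_⟩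
  refine (inner_center h.val x p _ _).trans (Eq.trans ?_ hr.2)
  exact congrArg₂ (fun a b : F => (h.val (x p) : F →L[ℝ] F →L[ℝ] ℝ) a b)
    (fderiv_chartMap_center hx.contMDiff p _) (coframe_center (E := E) x (fun q => N (x q)) p)

theorem formB_eq_sff {U : Set M} (hU : IsOpen U) {Y : ∀ p : M, TangentSpace 𝓘(ℝ, E) p}
    (hY : SmoothFieldOn Y U) {p : M} (hp : p ∈ U) {ξ : E}
    (hξ : rigged (E := E) h.val x N p = ξ) (u w : E) (hw : Y p = w) :
    formB (E := E) h.val x N p u Y =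
      sff (inChart h.val (x p)) (chartMap (E := E) (F := F) x p (x p)) (extChartAt 𝓘(ℝ, E) p p)
        ξ u w := by
  have hr := (rigged_center h x hx N hN hξ).1
  have e1 := covDerivAlong_tangent h x hx.contMDiff hU hY hp u w hw
  have e2 := (isMetricAlong_chart h hx.contMDiff (center_mem_chartDomain x p)).symm.self_of_nhds
  subst hξ
  refine (inner_tangent_center h.val hx.contMDiff p _ _).symm.trans ?_
  rw [e1, map_add, add_apply, e2 (fderiv ℝ _ _ _), hr, add_zero]
  rfl

omit [FiniteDimensional ℝ F] [FiniteDimensional ℝ E] hN in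
theorem tau_eq_shape {p : M} {ξ : E} (hξ : rigged (E := E) h.val x N p = ξ) (u : E) :
    tau (E := E) h.val x N p u =
      shape (inChart h.val (x p)) (chartMap (E := E) (F := F) x p (x p)) (chartField x N p)
        (extChartAt 𝓘(ℝ, E) p p) u ξ := by
  subst hξ
  exact (inner_tangent_center h.val hx.contMDiff p _ _).symm.trans (congrArg (fun a : F =>
    inChart h.val (x p) (chartMap (E := E) (F := F) x p (x p) (extChartAt 𝓘(ℝ, E) p p)) a
      (fderiv ℝ (chartMap (E := E) (F := F) x p (x p)) (extChartAt 𝓘(ℝ, E) p p)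
        (rigged (E := E) h.val x N p)))
    (covDerivAlong_eq_covD (E := E) h.val hx.contMDiff (fun q => N (x q)) p u))

omit [FiniteDimensional ℝ E] hN in
theorem formC_eq_neg_shape {U : Set M} (hU : IsOpen U) {Y : ∀ p : M, TangentSpace 𝓘(ℝ, E) p}
    (hY : SmoothFieldOn Y U) (hYS : ∀ p ∈ U, eta (E := E) h.val x N p (Y p) = 0) {a : E → ℝ}
    {p : M} (hp : p ∈ U)
    (hR : IsRiggedAt (inChart h.val (x p)) (chartMap (E := E) (F := F) x p (x p))
      (chartField x N p) a (extChartAt 𝓘(ℝ, E) p p)) (u w : E) (hw : Y p = w) :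
    formC (E := E) h.val x N p u Y =
      -shape (inChart h.val (x p)) (chartMap (E := E) (F := F) x p (x p)) (chartField x N p)
        (extChartAt 𝓘(ℝ, E) p p) u w := by
  have hy := center_mem_chartDomain (E := E) (F := F) x p
  have hT := contDiffAt_chartField_id hU hY hp
  have hTp : chartField (F := E) (id : M → M) Y p (extChartAt 𝓘(ℝ, E) p p) = w :=
    (coframe_center (E := E) (F := E) (id : M → M) Y p).trans hw
  have hn : chartField x N p (extChartAt 𝓘(ℝ, E) p p) = N (x p) :=
    coframe_center (E := E) x (fun q => N (x q)) p
  have hUy : ∀ᶠ y in 𝓝 (extChartAt 𝓘(ℝ, E) p p), (extChartAt 𝓘(ℝ, E) p).symm y ∈ U := by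
    refine (contMDiffAt_chart_symm hy.1).continuousAt.eventually (hU.mem_nhds ?_)
    rw [extChartAt_to_inv]; exact hp
  have hev : (fun y => coordEta (inChart h.val (x p)) (chartMap (E := E) (F := F) x p (x p))
      (chartField x N p) y (chartField (F := E) (id : M → M) Y p y))
      =ᶠ[𝓝 (extChartAt 𝓘(ℝ, E) p p)] fun _ => 0 := by
    filter_upwards [chartDomain_mem_nhds hx.contMDiff hy, hUy] with y hy' hyU
    rw [coordEta_chart hx.contMDiff hy', formInChart_apply]
    exact (congrArg _ (frame_coframe ((extChartAt 𝓘(ℝ, E) p).map_target hy'.1) _)).trans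
      (hYS _ hyU)
  have h1 := congrArg (fun L : E →L[ℝ] ℝ => L u) (hev.fderiv_eq (𝕜 := ℝ))
  have h2 := fderiv_clm_apply_apply (differentiableAt_of_smooth hR.contDiffAt_eta)
    (differentiableAt_of_smooth hT) u
  rw [hR.fderiv_eta, hTp, coordEta_apply] at h2
  simp only [fderiv_fun_const, Pi.zero_apply, zero_apply] at h1
  obtain ⟨A, hA⟩ : ∃ A : F, covDerivAlong (E := E) h.val x
      (fun q => diff (E := E) (F := F) x q (Y q)) p u = A := ⟨_, rfl⟩
  have e1 := hA.symm.trans (covDerivAlong_tangent h x hx.contMDiff hU hY hp u w hw)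
  have e2 : formC (E := E) h.val x N p u Y =
      inChart h.val (x p) (chartMap (E := E) (F := F) x p (x p) (extChartAt 𝓘(ℝ, E) p p))
        (A - formB (E := E) h.val x N p u Y • chartField x N p (extChartAt 𝓘(ℝ, E) p p))
        (chartField x N p (extChartAt 𝓘(ℝ, E) p p)) := by
    rw [hn, ← hA]
    exact (inner_center h.val x p _ _).symm
  rw [e2, hR.symm_at, e1, map_sub, map_smul, hR.null, map_add, smul_zero, sub_zero]
  linarith

end Center

end NullHyp

end

theorem mainTheorem9
    {E : Type*} [NormedAddCommGroup E] [NormedSpace ℝ E] [FiniteDimensional ℝ E]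
    {M : Type*} [TopologicalSpace M] [ChartedSpace E M] [IsManifold 𝓘(ℝ, E) ∞ M]
    {F : Type*} [NormedAddCommGroup F] [NormedSpace ℝ F] [FiniteDimensional ℝ F]
    {M' : Type*} [TopologicalSpace M'] [ChartedSpace F M'] [IsManifold 𝓘(ℝ, F) ∞ M']
    -- the ambient semi-Riemannian manifold and a closed rigged null hypersurface of it
    (h : NullHyp.SemiRiemannianMetric F M') (x : M → M')
    (hx : NullHyp.IsNullHypersurface (E := E) h x)
    (N : ∀ q : M', TangentSpace 𝓘(ℝ, F) q)
    (hN : NullHyp.IsNullRigging (E := E) h x N)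
    (hclosed : NullHyp.IsClosedForm (NullHyp.eta (E := E) h.val x N))
    -- a nowhere vanishing smooth function, constant on each leaf of the screen distribution
    (α : M → ℝ) (hα : ContMDiff 𝓘(ℝ, E) 𝓘(ℝ, ℝ) ∞ α) (hα0 : ∀ p, α p ≠ 0)
    (hleaf : NullHyp.ConstantOnLeaves (NullHyp.eta (E := E) h.val x N) α)
    -- two orthogonal (local) sections of the screen distribution
    (U : Set M) (hU : IsOpen U) (X Y : ∀ p : M, TangentSpace 𝓘(ℝ, E) p)
    (hX : NullHyp.SmoothFieldOn X U) (hY : NullHyp.SmoothFieldOn Y U)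
    (hXS : ∀ p ∈ U, NullHyp.eta h.val x N p (X p) = 0)
    (hYS : ∀ p ∈ U, NullHyp.eta h.val x N p (Y p) = 0)
    (hXY : ∀ p ∈ U, NullHyp.inducedForm h.val x p (X p) (Y p) = 0)
    (p : M) (hp : p ∈ U) :
    letI g := NullHyp.inducedForm (E := E) h.val x p
    letI gα := NullHyp.alphaMetric (E := E) h.val x N α
    letI ξ := NullHyp.rigged (E := E) h.val x N p
    letI τ := NullHyp.tau (E := E) h.val x N p
    letI dα := mvfderiv 𝓘(ℝ, E) α p
    letI B := NullHyp.formB (E := E) h.val x N p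
    letI C := NullHyp.formC (E := E) h.val x N p
    letI dx := NullHyp.diff (E := E) (F := F) x p
    -- the plane spanned by `ξ` and `X`
    (g (X p) (X p) ≠ 0 →
      NullHyp.sectionalCurvature gα p ξ (X p) =
          1 / (α p * g (X p) (X p)) *
            (h.val (x p) (NullHyp.curvature h.val (x p) (dx ξ) (dx (X p)) (dx ξ)) (dx (X p))
              + (τ ξ + 1 / (2 * α p) * dα ξ) * B (X p) X) ∧
      NullHyp.sectionalCurvature gα p ξ (X p) =
          1 / (α p * g (X p) (X p)) *
            (g (X p) (X p) * NullHyp.nullSectionalCurvature h.val (x p) (dx ξ) (dx (X p))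
              + (τ ξ + 1 / (2 * α p) * dα ξ) * B (X p) X)) ∧
    -- the plane spanned by `X` and `Y`
    (g (X p) (X p) ≠ 0 → g (Y p) (Y p) ≠ 0 →
      NullHyp.sectionalCurvature gα p (X p) (Y p) =
          NullHyp.sectionalCurvature h.val (x p) (dx (X p)) (dx (Y p))
            + (B (X p) X * B (Y p) Y - B (X p) Y ^ 2) / (α p * g (X p) (X p) * g (Y p) (Y p))
            + (2 * B (X p) Y * C (X p) Y - B (X p) X * C (Y p) Y - B (Y p) Y * C (X p) X)
                / (g (X p) (X p) * g (Y p) (Y p))) := by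
  have hy := NullHyp.center_mem_chartDomain (E := E) (F := F) x p
  have hR : ∀ᶠ z in 𝓝 (extChartAt 𝓘(ℝ, E) p p), NullHyp.IsRiggedAt (NullHyp.inChart h.val (x p))
      (NullHyp.chartMap (E := E) (F := F) x p (x p)) (NullHyp.chartField x N p)
      (fun z => α ((extChartAt 𝓘(ℝ, E) p).symm z)) z :=
    Filter.mem_of_superset (NullHyp.chartDomain_mem_nhds hx.contMDiff hy) fun z hz =>
      NullHyp.isRiggedAt_chart h x hx N hN hclosed α hα hα0 hleaf hz
  have hH : NullHyp.inChart (NullHyp.alphaMetric (E := E) h.val x N α) p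
      =ᶠ[𝓝 (extChartAt 𝓘(ℝ, E) p p)] NullHyp.coordAlpha (NullHyp.inChart h.val (x p))
        (NullHyp.chartMap (E := E) (F := F) x p (x p)) (NullHyp.chartField x N p)
        (fun z => α ((extChartAt 𝓘(ℝ, E) p).symm z)) :=
    Filter.mem_of_superset (NullHyp.chartDomain_mem_nhds hx.contMDiff hy) fun z hz =>
      (NullHyp.coordAlpha_chart hx.contMDiff hz h.val N α).symm
  obtain ⟨ξ, hξ⟩ : ∃ ξ : E, NullHyp.rigged (E := E) h.val x N p = ξ := ⟨_, rfl⟩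
  obtain ⟨u, hu⟩ : ∃ u : E, X p = u := ⟨_, rfl⟩
  obtain ⟨v, hv⟩ : ∃ v : E, Y p = v := ⟨_, rfl⟩
  have hr := NullHyp.rigged_center h x hx N hN hξ
  have hRp := hR.self_of_nhds
  have hτ := NullHyp.tau_eq_shape h x hx N hξ ξ
  have hB := fun (w : E) => NullHyp.formB_eq_sff h x hx N hN hU hX hp hξ w u hu
  have hB' := fun (w : E) => NullHyp.formB_eq_sff h x hx N hN hU hY hp hξ w v hv
  have hC := fun (w : E) => NullHyp.formC_eq_neg_shape h x hx N hU hX hXS hp hRp w u hu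
  have hC' := fun (w : E) => NullHyp.formC_eq_neg_shape h x hx N hU hY hYS hp hRp w v hv
  have hα1 : α ((extChartAt 𝓘(ℝ, E) p).symm (extChartAt 𝓘(ℝ, E) p p)) = α p := by
    rw [extChartAt_to_inv]
  have hdα := NullHyp.mvfderiv_center (hα.mdifferentiable (by simp) p) ξ
  have hηu : NullHyp.coordEta (NullHyp.inChart h.val (x p))
      (NullHyp.chartMap (E := E) (F := F) x p (x p)) (NullHyp.chartField x N p)
      (extChartAt 𝓘(ℝ, E) p p) u = 0 := by
    subst hu
    rw [NullHyp.coordEta_chart hx.contMDiff hy]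
    exact (NullHyp.formInChart_center _ p _).trans (hXS p hp)
  have hηv : NullHyp.coordEta (NullHyp.inChart h.val (x p))
      (NullHyp.chartMap (E := E) (F := F) x p (x p)) (NullHyp.chartField x N p)
      (extChartAt 𝓘(ℝ, E) p p) v = 0 := by
    subst hv
    rw [NullHyp.coordEta_chart hx.contMDiff hy]
    exact (NullHyp.formInChart_center _ p _).trans (hYS p hp)
  have hg := NullHyp.inner_tangent_tangent_center (E := E) h.val hx.contMDiff p
  have hcurv := NullHyp.curvature_center (E := E) h.val hx.contMDiff p
  have huv : NullHyp.inducedForm (E := E) h.val x p u v = 0 := by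
    subst hu hv
    exact hXY p hp
  have hK1 := NullHyp.sectionalCurvature_eq hH ξ u
  have hK2 := NullHyp.sectionalCurvature_eq hH u v
  rw [NullHyp.IsRiggedAt.alpha_curvature_radical hR hr.1 hr.2 u hηu] at hK1
  rw [NullHyp.IsRiggedAt.alpha_curvature_screen hR hr.1 hr.2 u v hηu hηv] at hK2
  simp only [NullHyp.coordAlpha_apply, hr.1, hηu, hηv, hRp.eta_radical hr.2, hg, hcurv, hα1, huv]
    at hK1 hK2
  rw [hξ, hu, hv]
  refine ⟨fun hXX => ⟨?_, ?_⟩, fun hXX hYY => ?_⟩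
  · rw [hK1, hτ, hB, hdα]
    have hα2 := hα0 p
    field_simp
    ring
  · rw [hK1, hτ, hB, hdα]
    have hα2 := hα0 p
    have hn : NullHyp.inducedForm (E := E) h.val x p u u *
        NullHyp.nullSectionalCurvature h.val (x p) (NullHyp.diff (E := E) (F := F) x p ξ)
          (NullHyp.diff (E := E) (F := F) x p u) =
        h.val (x p) (NullHyp.curvature h.val (x p) (NullHyp.diff (E := E) (F := F) x p ξ)
          (NullHyp.diff (E := E) (F := F) x p u) (NullHyp.diff (E := E) (F := F) x p ξ))
          (NullHyp.diff (E := E) (F := F) x p u) := mul_div_cancel₀ _ hXX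
    rw [hn]
    field_simp
    ring
  · rw [hK2, hB, hB', hB', hC, hC', hC', NullHyp.sectionalCurvature]
    have hα2 := hα0 p
    have e : ∀ w w' : E, h.val (x p) (NullHyp.diff (E := E) (F := F) x p w)
        (NullHyp.diff (E := E) (F := F) x p w') = NullHyp.inducedForm (E := E) h.val x p w w' :=
      fun _ _ => rfl
    rw [e, e, e, huv]
    field_simp
    ring
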